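/- Let $k$ be a perfect field with algebraic closure $\bar k$. A Severi–Brauer surface over $k$ is a smooth projective surface $S$ over $k$ such that $S_{\bar k}\cong\mathbb{P}^2_{\bar k}$ over $\bar k$; it is called non-trivial if it has no $k$-point (by a theorem of Châtelet, equivalently, if $S$ is not isomorphic to $\mathbb{P}^2_k$ over $k$). A $3$-point of $S$ is a closed point $p\in S$ whose residue field has degree $3$ over $k$; its components are the $\bar k$-points of $S$ lying over $p$. Let $S$ be a non-trivial Severi–Brauer surface over $k$ and let $\alpha\in\mathrm{Aut}_k(S)$ with $\alpha\neq\mathrm{id}$. Then there is exactly one $3$-point $p$ of $S$ all of whose components are fixed by $\alpha$. Moreover, $p$ has exactly three components, and they are precisely the $\bar k$-points of $S$ fixed by $\alpha$. -/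

import Mathlib

open CategoryTheory CategoryTheory.Limits AlgebraicGeometry

universe u

noncomputable section

namespace SeveriBrauer

attribute [local instance] MvPolynomial.gradedAlgebra

/-- The projective space `ℙⁿ_K = Proj K[x₀, …, xₙ]`, as a scheme over `Spec K`. The structure
morphism is `Proj A ⟶ Spec A₀ ⟶ Spec K` with `A = K[x₀, …, xₙ]`. -/
def projectiveSpace (n : ℕ) (K : Type u) [Field K] : Over (Spec (.of K)) :=
  Over.mk (Y := Proj (MvPolynomial.homogeneousSubmodule (Fin (n + 1)) K))
    (Proj.toSpecZero (MvPolynomial.homogeneousSubmodule (Fin (n + 1)) K) ≫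
      Spec.map (CommRingCat.ofHom
        (algebraMap K (MvPolynomial.homogeneousSubmodule (Fin (n + 1)) K 0))))

variable {k : Type u} [Field k]

/-- The morphism `Spec k̄ ⟶ Spec k` for the algebraic closure `k̄` of `k`. -/
def specAlgebraicClosure (k : Type u) [Field k] :
    Spec (.of (AlgebraicClosure k)) ⟶ Spec (.of k) :=
  Spec.map (CommRingCat.ofHom (algebraMap k (AlgebraicClosure k)))

/-- The base change `S_k̄ = S ×_k k̄`, as a scheme over `k̄`. -/
def geometricBaseChange (S : Over (Spec (.of k))) : Over (Spec (.of (AlgebraicClosure k))) :=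
  (Over.pullback (specAlgebraicClosure k)).obj S

/-- A scheme over `k` is projective if it is a closed subscheme of some `ℙⁿ_k`. -/
def IsProjective (S : Over (Spec (.of k))) : Prop :=
  ∃ (n : ℕ) (i : S ⟶ projectiveSpace n k), IsClosedImmersion i.left

/-- A Severi–Brauer surface over `k`: a smooth projective surface `S` over `k` such that
`S_k̄` is isomorphic to `ℙ²_k̄` over `k̄`. -/
structure IsSeveriBrauerSurface (S : Over (Spec (.of k))) : Prop where
  projective : IsProjective S
  smooth : SmoothOfRelativeDimension 2 S.hom
  geometric : Nonempty (geometricBaseChange S ≅ projectiveSpace 2 (AlgebraicClosure k))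

/-- A `k`-point of `S`: a section of the structure morphism `S ⟶ Spec k`. -/
abbrev RationalPoint (S : Over (Spec (.of k))) : Type u :=
  Over.mk (𝟙 (Spec (.of k))) ⟶ S

/-- A Severi–Brauer surface is trivial if it contains a `k`-point (by a theorem of Châtelet
this happens if and only if it is isomorphic to `ℙ²_k` over `k`). -/
def IsTrivial (S : Over (Spec (.of k))) : Prop :=
  Nonempty (RationalPoint S)

/-- A geometric point, or `k̄`-point, of `S`: a morphism `Spec k̄ ⟶ S` over `k`. -/
abbrev GeometricPoint (S : Over (Spec (.of k))) : Type u :=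
  Over.mk (specAlgebraicClosure k) ⟶ S

/-- The point of the underlying topological space of `S` at which a geometric point is
supported. -/
def GeometricPoint.support {S : Over (Spec (.of k))} (x : GeometricPoint S) : S.left :=
  x.left (IsLocalRing.closedPoint (AlgebraicClosure k))

/-- A `d`-point of `S`: a closed point whose residue field has degree `d` over `k`. -/
structure IsDPoint (d : ℕ) {S : Over (Spec (.of k))} (p : S.left) : Prop where
  isClosed : IsClosed {p}
  degree : S.hom.residueDegree p = d

/-- The components of a point `p` of `S`: the geometric points of `S` lying over `p`. -/
def components {S : Over (Spec (.of k))} (p : S.left) : Set (GeometricPoint S) :=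
  {x | x.support = p}

/-- The geometric point `x` is fixed by the automorphism `α` of `S` over `k`, i.e.
`α(x) = x` for the action of `α` on `S(k̄)`. -/
def Fixes {S : Over (Spec (.of k))} (α : Aut S) (x : GeometricPoint S) : Prop :=
  x ≫ α.hom = x

/-- The automorphism `α` fixes the point `p` componentwise. -/
def FixesComponentwise {S : Over (Spec (.of k))} (α : Aut S) (p : S.left) : Prop :=
  ∀ x ∈ components p, Fixes α x

end SeveriBrauer

end

/-! Over `k̄` the automorphism `α` becomes an automorphism of `ℙ²`, hence is given by an invertible
linear map `A`, and its fixed geometric points are the eigenlines of `A`. An element of the Galois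
group acts on homogeneous coordinates by an injective semilinear map `T`. Since the Galois action
commutes with `α`, and `A` and `T` matter only up to scalars, `A ∘ T = c • T ∘ A` for some `c ≠ 0`.

The linear algebra is `exists_isCanonicalLine_or`. A non-scalar `A` in dimension 3 either has three
distinct eigenvalues or singles out a line preserved by every such `T`. In the second case the line
is a Galois-invariant geometric point, which descends to a `k`-point because `k` is perfect
(`isTrivial_of_galoisAct_eq`), against non-triviality. So `A` has three distinct eigenvalues and `α`
fixes exactly three geometric points. `A` is not scalar, because an automorphism that fixes all
geometric points is the identity (`eq_one_of_fixes`).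

The Galois group permutes these three points. Its orbits are the sets of components of points of
`S`, and none has a single element; two disjoint orbits would need at least four points, so there is
one orbit. It lies over a closed point, whose degree is the number of its components, namely 3,
again by perfectness (`exists_fixedPoints_eq_components`). Any other 3-point fixed componentwise
would have its components in the same orbit.

Linearity of automorphisms of `ℙⁿ` is proved by elementary means: local polynomial expressions are
glued into a global one by unique factorization, and composing with the inverse forces degree one
(`IsRegularMap.exists_linearMap`). -/

/-! ### Proportional tuples -/

/-- Two tuples are proportional if all their `2 × 2` minors vanish. -/
def Proportional {σ R : Type*} [Mul R] (v w : σ → R) : Prop :=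
  ∀ i j, v i * w j = v j * w i

namespace Proportional

variable {σ R : Type*} [CommRing R]

lemma symm {v w : σ → R} (h : Proportional v w) : Proportional w v := fun i j => by
  linear_combination h j i

lemma smul_right (v : σ → R) (c : R) : Proportional v (c • v) := fun i j => by
  simp only [Pi.smul_apply, smul_eq_mul]; ring

lemma exists_smul {K : Type*} [Field K] {v w : σ → K} (h : Proportional v w) (hv : v ≠ 0) :
    ∃ c : K, w = c • v := by
  obtain ⟨i, hi⟩ := Function.ne_iff.1 hv
  simp only [Pi.zero_apply] at hi
  refine ⟨w i / v i, funext fun j => ?_⟩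
  simp only [Pi.smul_apply, smul_eq_mul]
  have := h i j
  field_simp
  linear_combination this

lemma exists_smul_ne {K : Type*} [Field K] {v w : σ → K} (h : Proportional v w) (hv : v ≠ 0)
    (hw : w ≠ 0) : ∃ c : K, c ≠ 0 ∧ w = c • v := by
  obtain ⟨c, rfl⟩ := h.exists_smul hv
  exact ⟨c, fun hc => hw (by simp [hc]), rfl⟩

lemma trans {K : Type*} [Field K] {u v w : σ → K} (h : Proportional u v) (h' : Proportional v w)
    (hv : v ≠ 0) : Proportional u w := by
  obtain ⟨c, rfl⟩ := h.symm.exists_smul hv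
  obtain ⟨d, rfl⟩ := h'.exists_smul hv
  intro i j
  simp only [Pi.smul_apply, smul_eq_mul]; ring

lemma map {R' : Type*} [CommRing R'] (f : R →+* R') {v w : σ → R} (h : Proportional v w) :
    Proportional (f ∘ v) (f ∘ w) := fun i j => by
  simp only [Function.comp_apply, ← map_mul, h i j]

/-- If the entries of `f` have no common factor, every tuple proportional to `f` is a multiple
of `f`. -/
lemma exists_eq_smul_of_gcd_eq_one [Fintype σ] [IsDomain R] [NormalizedGCDMonoid R] {f g : σ → R}
    (hf : f ≠ 0) (hgcd : Finset.univ.gcd f = 1) (h : Proportional f g) : ∃ a : R, g = a • f := by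
  obtain ⟨j, hj⟩ := Function.ne_iff.1 hf
  simp only [Pi.zero_apply] at hj
  -- `f j` divides every `f i * g j = f j * g i`, hence their gcd, which is `g j` up to a unit; the
  -- quotient is the factor `a`.
  have hdvd : f j ∣ Finset.univ.gcd (fun i => f i * g j) :=
    Finset.dvd_gcd fun i _ => ⟨g i, h i j⟩
  rw [(Finset.univ.gcd_mul_right' (f := f) (g j)).dvd_iff_dvd_right, hgcd, one_mul] at hdvd
  obtain ⟨a, ha⟩ := hdvd
  refine ⟨a, funext fun i => mul_left_cancel₀ hj ?_⟩
  rw [← h i j, ha]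
  simp only [Pi.smul_apply, smul_eq_mul]; ring

end Proportional

/-! ### Homogeneous polynomials and polynomials without zeros -/

namespace MvPolynomial

variable {σ K : Type*} [Field K]

/-- The substitution `xᵢ ↦ xᵢ t`, which separates the homogeneous components. -/
noncomputable def homogenizeHom (σ K : Type*) [Field K] :
    MvPolynomial σ K →ₐ[K] Polynomial (MvPolynomial σ K) :=
  aeval fun i => Polynomial.C (X i) * Polynomial.X

lemma homogenizeHom_monomial (s : σ →₀ ℕ) (c : K) :
    homogenizeHom σ K (monomial s c) = Polynomial.monomial s.degree (monomial s c) := by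
  rw [homogenizeHom, aeval_monomial, ← Polynomial.C_mul_X_pow_eq_monomial, monomial_eq,
    Finsupp.degree, Finsupp.prod, Finsupp.prod]
  simp only [mul_pow, Finset.prod_mul_distrib, Finset.prod_pow_eq_pow_sum, map_mul, map_prod,
    map_pow, mul_assoc]
  rfl

lemma IsHomogeneous.homogenizeHom_eq {p : MvPolynomial σ K} {n : ℕ} (hp : p.IsHomogeneous n) :
    homogenizeHom σ K p = Polynomial.monomial n p := by
  conv_lhs => rw [p.as_sum]
  conv_rhs => rw [p.as_sum]
  rw [map_sum, map_sum]
  refine Finset.sum_congr rfl fun s hs => ?_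
  rw [homogenizeHom_monomial, hp.degree_eq_sum_deg_support hs]
  rfl

/-- The coefficient of `t ^ m` in `homogenizeHom σ K p` is the homogeneous component of `p` of
degree `m`. -/
lemma isHomogeneous_of_homogenizeHom_eq {p q : MvPolynomial σ K} {n : ℕ}
    (h : homogenizeHom σ K p = Polynomial.monomial n q) : p.IsHomogeneous n := by
  intro s hs
  by_contra hne
  have key : ∀ p : MvPolynomial σ K, ∀ m, (homogenizeHom σ K p).coeff m =
      homogeneousComponent m p := by
    intro p m
    induction p using MvPolynomial.induction_on' with
    | monomial s c =>
      rw [homogenizeHom_monomial, Polynomial.coeff_monomial]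
      have := isHomogeneous_monomial (n := s.degree) c rfl
      rw [homogeneousComponent_of_mem this]
      simp only [eq_comm]
    | add p q hp hq => simp [hp, hq]
  have h1 := key p s.degree
  rw [h, Polynomial.coeff_monomial, if_neg] at h1
  · have h2 := congrArg (coeff s) h1
    rw [coeff_homogeneousComponent, if_pos rfl, coeff_zero] at h2
    exact hs h2.symm
  · rintro rfl
    exact hne (by simp [Finsupp.degree_eq_weight_one]; rfl)

/-- A factor of a nonzero homogeneous polynomial is homogeneous. -/
lemma IsHomogeneous.of_mul_left {p q : MvPolynomial σ K} {n : ℕ} (h : (p * q).IsHomogeneous n)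
    (hpq : p * q ≠ 0) : ∃ m, p.IsHomogeneous m := by
  have h1 := h.homogenizeHom_eq
  rw [map_mul] at h1
  have h0 : homogenizeHom σ K p * homogenizeHom σ K q ≠ 0 := by
    rw [h1]; simpa using hpq
  -- Degree and trailing degree in `t` are additive over a domain. They coincide for the image of `p
  -- * q`, hence for the image of each factor.
  have hd := congrArg Polynomial.natDegree h1
  have ht := congrArg Polynomial.natTrailingDegree h1
  rw [Polynomial.natDegree_mul (left_ne_zero_of_mul h0) (right_ne_zero_of_mul h0),
    Polynomial.natDegree_monomial_eq _ hpq] at hd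
  rw [Polynomial.natTrailingDegree_mul (left_ne_zero_of_mul h0) (right_ne_zero_of_mul h0),
    Polynomial.natTrailingDegree_monomial hpq] at ht
  have l1 := Polynomial.natTrailingDegree_le_natDegree (homogenizeHom σ K p)
  have l2 := Polynomial.natTrailingDegree_le_natDegree (homogenizeHom σ K q)
  refine ⟨(homogenizeHom σ K p).natDegree, isHomogeneous_of_homogenizeHom_eq
    (q := (homogenizeHom σ K p).leadingCoeff) ?_⟩
  ext1 m
  rw [Polynomial.coeff_monomial]
  split_ifs with hm
  · rw [← hm]; rfl
  · rcases lt_or_gt_of_ne hm with hm | hm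
    · exact Polynomial.coeff_eq_zero_of_natDegree_lt hm
    · exact Polynomial.coeff_eq_zero_of_lt_natTrailingDegree (by omega)

lemma IsHomogeneous.eval_smul {p : MvPolynomial σ K} {n : ℕ} (hp : p.IsHomogeneous n) (c : K)
    (v : σ → K) : eval (c • v) p = c ^ n * eval v p := by
  rw [eval_eq, eval_eq, Finset.mul_sum]
  refine Finset.sum_congr rfl fun s hs => ?_
  rw [hp.degree_eq_sum_deg_support hs, ← Finset.prod_pow_eq_pow_sum]
  simp only [Pi.smul_apply, smul_eq_mul, mul_pow, Finset.prod_mul_distrib]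
  ring

/-- Over an algebraically closed field, a polynomial in at least two variables that has no zero
away from the origin is constant. -/
lemma exists_eq_C_of_eval_ne_zero [IsAlgClosed K] [Nontrivial σ] {h : MvPolynomial σ K}
    (hh : ∀ v : σ → K, v ≠ 0 → eval v h ≠ 0) : ∃ c : K, c ≠ 0 ∧ h = C c := by
  classical
  -- On a line that misses the origin, `h` restricts to a one-variable polynomial without roots,
  -- that is, to a constant.
  have line : ∀ a b : σ → K, (∀ t : K, a + t • b ≠ 0) → eval a h = eval (a + b) h := by
    intro a b hab
    let P : Polynomial K :=
      aeval (fun i => Polynomial.C (a i) + Polynomial.X * Polynomial.C (b i)) h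
    have hP : ∀ t, P.eval t = eval (a + t • b) h := by
      intro t
      change Polynomial.evalRingHom t (aeval _ h) = _
      rw [aeval_def, hom_eval₂, ← eval₂_id]
      congr 1
      · ext x; simp
      · ext i; simp [mul_comm t]
    have hdeg : P.degree = 0 := by
      by_contra hne
      obtain ⟨t, ht⟩ := IsAlgClosed.exists_root P hne
      exact hh _ (hab t) ((hP t).symm.trans ht)
    have h0 := hP 0
    have h1 := hP 1
    rw [Polynomial.eq_C_of_degree_eq_zero hdeg] at h0 h1
    simp only [Polynomial.eval_C] at h0 h1
    simpa using h0.symm.trans h1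
  have pair : ∀ a b : σ → K, LinearIndependent K ![a, b] → eval a h = eval b h := by
    intro a b hab
    rw [LinearIndependent.pair_iff] at hab
    rw [line a b, line b a, add_comm]
    · intro t ht
      have := hab t 1 (by rw [one_smul, add_comm]; exact ht)
      simp at this
    · intro t ht
      have := hab 1 t (by rw [one_smul]; exact ht)
      simp at this
  have all : ∀ a b : σ → K, a ≠ 0 → b ≠ 0 → eval a h = eval b h := by
    intro a b ha hb
    by_cases hab : LinearIndependent K ![a, b]
    · exact pair a b hab
    · rw [LinearIndependent.pair_iff' ha] at hab
      push Not at hab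
      obtain ⟨c, rfl⟩ := hab
      -- Two vectors on the same line through the origin are compared via a standard basis vector
      -- independent of both.
      obtain ⟨i, hi⟩ := Function.ne_iff.1 ha
      simp only [Pi.zero_apply] at hi
      obtain ⟨j, hj⟩ := exists_ne i
      have hc : c ≠ 0 := by rintro rfl; simp at hb
      have hind : ∀ a : σ → K, a i ≠ 0 → LinearIndependent K ![a, Pi.single j 1] := by
        intro a hi
        rw [LinearIndependent.pair_iff]
        intro s t hst
        have h1 := congrFun hst i
        simp only [Pi.add_apply, Pi.smul_apply, smul_eq_mul, Pi.zero_apply,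
          Pi.single_eq_of_ne hj.symm, mul_zero, add_zero, mul_eq_zero, hi, or_false] at h1
        subst h1
        have h2 := congrFun hst j
        simpa using h2
      rw [pair a _ (hind a hi), pair (c • a) _ (hind _ (by simp [hc, hi]))]
  obtain ⟨i⟩ : Nonempty σ := inferInstance
  have hi : (Pi.single i 1 : σ → K) ≠ 0 := by simp
  refine ⟨eval (Pi.single i 1) h, hh _ hi, ?_⟩
  -- The values agree only away from the origin; the factor `X i` covers `v = 0`.
  have hX : (h - C (eval (Pi.single i 1) h)) * X i = 0 := by
    refine funext fun v => ?_
    by_cases hv : v = 0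
    · simp [hv]
    · simp [all v _ hv hi]
  exact sub_eq_zero.1 ((mul_eq_zero.1 hX).resolve_right (X_ne_zero i))

end MvPolynomial

/-! ### Regular self-maps of projective space -/

open MvPolynomial in
/-- A self-map of the nonzero vectors (only its values up to scalars matter) is regular if it is
given, locally in the Zariski topology, by homogeneous polynomials of the same degree. -/
def IsRegularMap {σ K : Type*} [Field K] (Φ : (σ → K) → σ → K) : Prop :=
  ∀ v : σ → K, v ≠ 0 → ∃ (d : ℕ) (F : σ → MvPolynomial σ K) (g : MvPolynomial σ K),
    (∀ i, (F i).IsHomogeneous d) ∧ eval v g ≠ 0 ∧ ∀ w : σ → K, w ≠ 0 → eval w g ≠ 0 →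
      (fun i => eval w (F i)) ≠ 0 ∧ Proportional (fun i => eval w (F i)) (Φ w)

namespace IsRegularMap

open MvPolynomial

variable {σ K : Type*} [Field K]

/-- Over an infinite field, a regular map is given globally by a single tuple of homogeneous
polynomials without common zeros. -/
lemma exists_global [Finite σ] [Nonempty σ] [Infinite K] {Φ : (σ → K) → σ → K}
    (h : IsRegularMap Φ) (h0 : ∀ v, v ≠ 0 → Φ v ≠ 0) :
    ∃ (d : ℕ) (F : σ → MvPolynomial σ K), (∀ i, (F i).IsHomogeneous d) ∧
      ∀ v : σ → K, v ≠ 0 → (fun i => eval v (F i)) ≠ 0 ∧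
        Proportional (fun i => eval v (F i)) (Φ v) := by
  classical
  have := Fintype.ofFinite σ
  let : NormalizedGCDMonoid (MvPolynomial σ K) :=
    Classical.choice inferInstance
  obtain ⟨i₀⟩ := ‹Nonempty σ›
  obtain ⟨v₀, hv₀⟩ : ∃ v : σ → K, v ≠ 0 := ⟨Pi.single i₀ 1, by simp⟩
  obtain ⟨d, F, g, hF, hg, hFg⟩ := h v₀ hv₀
  have hF0 : F ≠ 0 := by
    rintro rfl
    exact (hFg v₀ hv₀ hg).1 (by ext; simp)
  -- The coprime tuple `F'` works everywhere: any other local expression `G` turns out to be a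
  -- polynomial multiple of `F'`, so `F'` cannot vanish where `G` does not.
  obtain ⟨F', hFF', hgcd⟩ := Finset.univ.extract_gcd F ⟨i₀, Finset.mem_univ _⟩
  simp only [Finset.mem_univ, true_implies] at hFF'
  set q := Finset.univ.gcd F
  have hq : q ≠ 0 := by
    intro hq
    exact hF0 (funext fun i => by rw [hFF', hq, zero_mul]; rfl)
  have hF'0 : F' ≠ 0 := by
    rintro rfl
    exact hF0 (funext fun i => by rw [hFF']; simp)
  have hcomm : ∃ d', ∀ i, (F' i).IsHomogeneous d' := by
    obtain ⟨j, hj⟩ := Function.ne_iff.1 hF'0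
    have hj' : q * F' j ≠ 0 := mul_ne_zero hq hj
    obtain ⟨a, ha⟩ := IsHomogeneous.of_mul_left (hFF' j ▸ hF j) hj'
    refine ⟨d - a, fun i => ?_⟩
    by_cases hi : F' i = 0
    · rw [hi]; exact isHomogeneous_zero _ _ _
    · have hi' : q * F' i ≠ 0 := mul_ne_zero hq hi
      have h1 : (q * F' i).IsHomogeneous d := hFF' i ▸ hF i
      obtain ⟨b, hb⟩ := IsHomogeneous.of_mul_left (mul_comm q (F' i) ▸ h1)
        (mul_comm q (F' i) ▸ hi')
      have := h1.inj_right (ha.mul hb) hi'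
      rwa [this, Nat.add_sub_cancel_left]
  obtain ⟨d', hd'⟩ := hcomm
  refine ⟨d', F', hd', fun v hv => ?_⟩
  obtain ⟨e, G, g', hG, hg', hGg'⟩ := h v hv
  have hFG : Proportional F G := by
    intro i j
    have hgg : g * g' ≠ 0 := by
      refine mul_ne_zero ?_ ?_ <;> rintro rfl <;> simp at hg hg'
    -- The factor `g * g'` restricts the comparison to points where both expressions are valid, and
    -- `X i₀` excludes the origin.
    refine mul_right_cancel₀ (mul_ne_zero hgg (X_ne_zero i₀)) (MvPolynomial.funext fun w => ?_)
    by_cases hw : eval w (g * g' * X i₀) = 0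
    · rw [map_mul, map_mul (eval w) (F j * G i), hw, mul_zero, mul_zero]
    · have hw0 : w ≠ 0 := by rintro rfl; simp at hw
      simp only [map_mul, mul_eq_zero, not_or] at hw
      have h1 := (hFg w hw0 hw.1.1).2.trans (hGg' w hw0 hw.1.2).2.symm (h0 w hw0) i j
      rw [map_mul, map_mul (eval w) (F j * G i), map_mul, map_mul (eval w) (F j), h1]
  have hF'G : Proportional F' G := by
    intro i j
    refine mul_left_cancel₀ hq ?_
    rw [← mul_assoc, ← mul_assoc, ← hFF', ← hFF', hFG i j]
  obtain ⟨a, ha⟩ := hF'G.exists_eq_smul_of_gcd_eq_one hF'0 hgcd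
  have hGv : (fun i => eval v (G i)) = eval v a • fun i => eval v (F' i) := by
    ext i; simp [ha]
  obtain ⟨h1, h2⟩ := hGg' v hv hg'
  refine ⟨fun h3 => h1 (by rw [hGv, h3, smul_zero]), ?_⟩
  refine Proportional.trans ?_ h2 h1
  rw [hGv]
  exact Proportional.smul_right _ _

lemma apply_smul {d : ℕ} {F : σ → MvPolynomial σ K} (hF : ∀ i, (F i).IsHomogeneous d)
    (c : K) (v : σ → K) :
    (fun i => eval (c • v) (F i)) = c ^ d • fun i => eval v (F i) := by
  ext i; simp [(hF i).eval_smul]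

lemma exists_linearMap_of_isHomogeneous_one [Finite σ] {F : σ → MvPolynomial σ K}
    (hF : ∀ i, (F i).IsHomogeneous 1) :
    ∃ A : (σ → K) →ₗ[K] σ → K, ∀ v, A v = fun i => eval v (F i) := by
  have hadd : ∀ p : MvPolynomial σ K, p.IsHomogeneous 1 → ∀ v w,
      eval (v + w) p = eval v p + eval w p := by
    intro p hp v w
    rw [← mem_homogeneousSubmodule, homogeneousSubmodule_one_eq_span_X] at hp
    induction hp using Submodule.span_induction with
    | mem p hp => obtain ⟨i, rfl⟩ := hp; simp
    | zero => simp
    | add p q _ _ hp hq => rw [map_add, map_add, map_add, hp, hq]; ring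
    | smul c p _ hp => rw [smul_eval, smul_eval, smul_eval, hp]; ring
  exact ⟨{ toFun := fun v i => eval v (F i)
           map_add' := fun v w => funext fun i => hadd _ (hF i) v w
           map_smul' := fun c v => by
            rw [apply_smul hF, pow_one]; rfl }, fun _ => rfl⟩

/-- Matches the twists of a semilinear automorphism and its inverse: if `τ ∘ P` and `τ.symm ∘ Q` are
their regular maps, the inverse of the first on projective points is `v ↦ Q (τ.symm ∘ v)`, the
conjugate of the second. -/
lemma conj {Φ : (σ → K) → σ → K} (h : IsRegularMap Φ) (τ : K ≃+* K) :
    IsRegularMap fun v => τ ∘ Φ (τ.symm ∘ v) := by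
  have h0 : ∀ v : σ → K, v ≠ 0 → τ.symm ∘ v ≠ 0 := fun v hv h =>
    hv (funext fun i => τ.symm.injective (by simpa using congrFun h i))
  have heval : ∀ (p : MvPolynomial σ K) (v : σ → K),
      eval v (MvPolynomial.map (τ : K →+* K) p) = τ (eval (τ.symm ∘ v) p) := by
    intro p v
    rw [MvPolynomial.eval_map, ← eval₂_id p]
    change _ = (τ : K →+* K) _
    rw [hom_eval₂, RingHom.comp_id]
    congr 1
    ext i; simp
  intro v hv
  obtain ⟨d, F, g, hF, hg, hFg⟩ := h _ (h0 v hv)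
  refine ⟨d, fun i => MvPolynomial.map (τ : K →+* K) (F i), MvPolynomial.map (τ : K →+* K) g,
    fun i => (hF i).map _, by simpa [heval] using hg, fun w hw hgw => ?_⟩
  obtain ⟨h1, h2⟩ := hFg _ (h0 w hw) (by simpa [heval] using hgw)
  simp only [heval]
  exact ⟨fun h => h1 (funext fun i => τ.injective (by simpa using congrFun h i)),
    h2.map (τ : K →+* K)⟩

/-- Over an algebraically closed field, a regular self-map of projective space with a regular
left inverse is linear. -/
theorem exists_linearMap [Finite σ] [Nontrivial σ] [IsAlgClosed K] {Φ Ψ : (σ → K) → σ → K}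
    (hΦ : IsRegularMap Φ) (hΨ : IsRegularMap Ψ) (hΦ0 : ∀ v, v ≠ 0 → Φ v ≠ 0)
    (hΨ0 : ∀ v, v ≠ 0 → Ψ v ≠ 0) (hΨΦ : ∀ v, v ≠ 0 → Proportional (Ψ (Φ v)) v) :
    ∃ A : (σ → K) →ₗ[K] σ → K, ∀ v, v ≠ 0 → A v ≠ 0 ∧ Proportional (A v) (Φ v) := by
  have : Infinite K := IsAlgClosed.instInfinite
  have := Fintype.ofFinite σ
  obtain ⟨d, F, hF, hFΦ⟩ := hΦ.exists_global hΦ0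
  obtain ⟨e, G, hG, hGΨ⟩ := hΨ.exists_global hΨ0
  -- `H` is the polynomial composite of `F` and `G`. Being proportional to `X`, it equals `a • X`;
  -- here `a` has no zero off the origin, so it is constant, and degrees give `d * e = 1`.
  let H : σ → MvPolynomial σ K := fun i => aeval F (G i)
  have hHeval : ∀ v, (fun i => eval v (H i)) = fun i => eval (fun j => eval v (F j)) (G i) := by
    intro v
    ext i
    simp only [H, aeval_def, hom_eval₂]
    rw [← eval₂_id]
    congr 1
    ext x; simp
  have hHv : ∀ v, v ≠ 0 → (fun i => eval v (H i)) ≠ 0 ∧ Proportional (fun i => eval v (H i)) v := by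
    intro v hv
    obtain ⟨h1, h2⟩ := hFΦ v hv
    obtain ⟨c, hc, hcv⟩ := h2.symm.exists_smul_ne (hΦ0 v hv) h1
    obtain ⟨h3, h4⟩ := hGΨ _ (hΦ0 v hv)
    have h5 : (fun i => eval v (H i)) = c ^ e • fun i => eval (Φ v) (G i) := by
      rw [hHeval, hcv, apply_smul hG]
    have h6 := smul_ne_zero (pow_ne_zero e hc) h3
    refine ⟨h5 ▸ h6, h5 ▸ ?_⟩
    refine ((Proportional.smul_right _ (c ^ e)).symm.trans h4 h3).trans (hΨΦ v hv)
      (hΨ0 _ (hΦ0 v hv))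
  have hHhom : ∀ i, (H i).IsHomogeneous (d * e) := fun i => (hG i).aeval _ hF
  have hHX : Proportional H X := by
    intro i j
    refine MvPolynomial.funext fun v => ?_
    by_cases hv : v = 0
    · simp [hv]
    · simpa using (hHv v hv).2 i j
  obtain ⟨i, j, hij⟩ := exists_pair_ne σ
  obtain ⟨a, ha⟩ : (X i : MvPolynomial σ K) ∣ H i := by
    have h1 : (X i : MvPolynomial σ K) ∣ H i * X j := hHX i j ▸ Dvd.intro_left _ rfl
    refine (X_prime.dvd_or_dvd h1).resolve_right ?_
    simpa using hij
  have hH : ∀ l, H l = a * X l := by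
    intro l
    refine mul_right_cancel₀ (X_ne_zero i) ?_
    rw [hHX l i, ha]; ring
  obtain ⟨c, hc, rfl⟩ := exists_eq_C_of_eval_ne_zero (h := a) fun v hv hav =>
    (hHv v hv).1 (funext fun l => by simp [hH, hav])
  have hde : d * e = 1 := by
    refine (hHhom i).inj_right ?_ ?_
    · rw [hH]; exact isHomogeneous_C_mul_X c i
    · rw [hH]; exact mul_ne_zero (by simpa using hc) (X_ne_zero i)
  obtain rfl := (mul_eq_one.1 hde).1
  obtain ⟨A, hA⟩ := exists_linearMap_of_isHomogeneous_one hF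
  exact ⟨A, fun v hv => by rw [hA]; exact hFΦ v hv⟩

end IsRegularMap

/-! ### Eigenlines preserved by semilinear symmetries -/

section Semilinear

open Module End

variable {K V : Type*} [Field K] [AddCommGroup V] [Module K V]

/-- The line through `v` is preserved by every injective semilinear map that commutes with `A` up
to a nonzero scalar. -/
def IsCanonicalLine (A : End K V) (v : V) : Prop :=
  ∀ (σ : K ≃+* K) (T : V →ₛₗ[(σ : K →+* K)] V) (c : K), Function.Injective T → c ≠ 0 →
    (∀ v, A (T v) = c • T (A v)) → ∃ t : K, T v = t • v

lemma exists_isCanonicalLine_of_finrank_eq_one {A : End K V} (W : Submodule K V)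
    (hW : finrank K W = 1)
    (h : ∀ (σ : K ≃+* K) (T : V →ₛₗ[(σ : K →+* K)] V) (c : K), Function.Injective T → c ≠ 0 →
      (∀ v, A (T v) = c • T (A v)) → ∀ w ∈ W, T w ∈ W) :
    ∃ v : V, v ≠ 0 ∧ IsCanonicalLine A v := by
  obtain ⟨v, hv, hvW⟩ := finrank_eq_one_iff'.1 hW
  refine ⟨v, by simpa using hv, fun σ T c hT hc hA => ?_⟩
  obtain ⟨t, ht⟩ := hvW ⟨T v, h σ T c hT hc hA v v.2⟩
  exact ⟨t, congrArg Subtype.val ht.symm⟩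

section

variable {A : End K V} {σ : K ≃+* K} {T : V →ₛₗ[(σ : K →+* K)] V} {c : K}
  (hA : ∀ v, A (T v) = c • T (A v))

include hA

lemma map_mem_eigenspace {a : K} {v : V} (hv : v ∈ eigenspace A a) :
    T v ∈ eigenspace A (c * σ a) := by
  rw [mem_eigenspace_iff] at hv ⊢
  rw [hA, hv, T.map_smulₛₗ, smul_smul]
  rfl

lemma hasEigenvalue_map (hT : Function.Injective T) {a : K} (ha : A.HasEigenvalue a) :
    A.HasEigenvalue (c * σ a) := by
  obtain ⟨v, hv⟩ := ha.exists_hasEigenvector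
  exact hasEigenvalue_of_hasEigenvector
    ⟨map_mem_eigenspace hA hv.1, fun h => hv.2 (hT (by rw [h, map_zero]))⟩

lemma map_sub_algebraMap_apply (hc : c ≠ 0) (a : K) (v : V) :
    T ((A - algebraMap K _ a) v) = (A - algebraMap K _ (c * σ a)) (c⁻¹ • T v) := by
  simp only [LinearMap.sub_apply, Module.algebraMap_end_apply, map_sub, map_smul, hA,
    T.map_smulₛₗ]
  rw [smul_sub, smul_smul, smul_smul, inv_mul_cancel₀ hc, ← mul_assoc, inv_mul_cancel₀ hc,
    one_smul, one_mul]
  rfl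

/-- `T` restricts to an injective semilinear map between the two eigenspaces. This prevents a
symmetry from exchanging eigenspaces of different dimensions. -/
lemma finrank_eigenspace_le [FiniteDimensional K V] (hT : Function.Injective T) {a : K} :
    finrank K (eigenspace A a) ≤ finrank K (eigenspace A (c * σ a)) := by
  let j : eigenspace A a →+ eigenspace A (c * σ a) :=
    { toFun := fun v => ⟨T v, map_mem_eigenspace hA v.2⟩
      map_zero' := by ext; simp
      map_add' := fun v w => by ext; simp }
  have := rank_le_of_surjective_injective (R := K) σ j σ.surjective
    (fun v w h => Subtype.ext (hT (congrArg Subtype.val h)))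
    (fun r m => Subtype.ext (T.map_smulₛₗ r m))
  exact finrank_le_finrank_of_rank_le_rank (by simpa using this) (rank_lt_aleph0 K _)

end

variable [FiniteDimensional K V] {A : End K V}

/-- In dimension 3 the nonzero, non-injective map `A - a` has a kernel or a range of dimension 1.
Either is preserved by the symmetries, since they all fix `a`. -/
lemma exists_isCanonicalLine_of_eigenvalue (hV : finrank K V = 3)
    (hA : ∀ a : K, A ≠ algebraMap K _ a) {a : K} (ha : A.HasEigenvalue a)
    (h : ∀ (σ : K ≃+* K) (T : V →ₛₗ[(σ : K →+* K)] V) (c : K), Function.Injective T → c ≠ 0 →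
      (∀ v, A (T v) = c • T (A v)) → c * σ a = a) :
    ∃ v : V, v ≠ 0 ∧ IsCanonicalLine A v := by
  set N := A - algebraMap K _ a
  have hN : LinearMap.ker N = eigenspace A a := eigenspace_def.symm
  have hsum := N.finrank_range_add_finrank_ker
  have h1 : 1 ≤ finrank K (LinearMap.ker N) := by
    rw [hN, Submodule.one_le_finrank_iff]
    exact ha
  have h2 : 1 ≤ finrank K (LinearMap.range N) := by
    rw [Submodule.one_le_finrank_iff, Ne, LinearMap.range_eq_bot]
    exact sub_ne_zero.2 (hA a)
  have h3 : finrank K (LinearMap.ker N) = 1 ∨ finrank K (LinearMap.range N) = 1 := by omega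
  rcases h3 with h3 | h3
  · refine exists_isCanonicalLine_of_finrank_eq_one _ h3 fun σ T c hT hc hAT w hw => ?_
    rw [hN] at hw ⊢
    exact h σ T c hT hc hAT ▸ map_mem_eigenspace hAT hw
  · refine exists_isCanonicalLine_of_finrank_eq_one _ h3 fun σ T c hT hc hAT w hw => ?_
    obtain ⟨u, rfl⟩ := hw
    rw [map_sub_algebraMap_apply hAT hc, h σ T c hT hc hAT]
    exact ⟨_, rfl⟩

/-- A non-scalar endomorphism of a three-dimensional space over an algebraically closed field has
three distinct eigenvalues or there is a line fixed by all semilinear symmetries. -/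
theorem exists_isCanonicalLine_or [IsAlgClosed K] (hV : finrank K V = 3)
    (hA : ∀ a : K, A ≠ algebraMap K _ a) :
    (∃ v : V, v ≠ 0 ∧ IsCanonicalLine A v) ∨
      ∃ (μ : Fin 3 → K) (b : Fin 3 → V), Function.Injective μ ∧
        ∀ i, A.HasEigenvector (μ i) (b i) := by
  have : Nontrivial V := nontrivial_of_finrank_pos (R := K) (by omega)
  obtain ⟨a, ha⟩ := exists_eigenvalue A
  -- A symmetry sends an eigenvalue `a` to the eigenvalue `c * σ a`, so it fixes a unique
  -- eigenvalue.
  by_cases h1 : ∀ b, A.HasEigenvalue b → b = a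
  · exact .inl (exists_isCanonicalLine_of_eigenvalue hV hA ha fun σ T c hT hc hAT =>
      h1 _ (hasEigenvalue_map hAT hT ha))
  push Not at h1
  obtain ⟨b, hb, hba⟩ := h1
  by_cases h2 : ∃ d, A.HasEigenvalue d ∧ d ≠ a ∧ d ≠ b
  · right
    obtain ⟨d, hd, hda, hdb⟩ := h2
    have hev : ∀ i, A.HasEigenvalue (![a, b, d] i) := by
      intro i; fin_cases i <;> assumption
    choose v hv using fun i => (hev i).exists_hasEigenvector
    refine ⟨_, v, ?_, hv⟩
    intro i j hij
    fin_cases i <;> fin_cases j <;> simp_all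
  push Not at h2
  have hswap : ∀ (σ : K ≃+* K) (T : V →ₛₗ[(σ : K →+* K)] V) (c : K), Function.Injective T →
      c ≠ 0 → (∀ v, A (T v) = c • T (A v)) →
      (c * σ a = a ∧ c * σ b = b) ∨ (c * σ a = b ∧ c * σ b = a) := by
    intro σ T c hT hc hAT
    have e1 := hasEigenvalue_map hAT hT ha
    have e2 := hasEigenvalue_map hAT hT hb
    have hne : c * σ b ≠ c * σ a := fun h => hba (σ.injective (mul_left_cancel₀ hc h))
    have h3 := h2 _ e1
    have h4 := h2 _ e2
    by_cases h5 : c * σ a = a <;> by_cases h6 : c * σ b = a <;> simp_all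
  left
  set P := (A - algebraMap K _ a) * (A - algebraMap K _ b) with hP
  have hcomm : P = (A - algebraMap K _ b) * (A - algebraMap K _ a) :=
    (((Commute.refl A).sub_left (Algebra.commutes a A)).sub_right
      ((Algebra.commutes b _).symm)).eq
  have hdisj : Disjoint (eigenspace A a) (eigenspace A b) :=
    A.eigenspaces_iSupIndep.pairwiseDisjoint hba.symm
  have ha1 : 1 ≤ finrank K (eigenspace A a) := Submodule.one_le_finrank_iff.2 ha
  have hb1 : 1 ≤ finrank K (eigenspace A b) := Submodule.one_le_finrank_iff.2 hb
  have hsup := Submodule.finrank_add_finrank_le_of_disjoint hdisj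
  -- If `P = 0`, the two eigenspaces have total dimension 3; a symmetry swapping `a` and `b` would
  -- make their dimensions equal, so none does.
  by_cases hP0 : P = 0
  · refine exists_isCanonicalLine_of_eigenvalue hV hA ha fun σ T c hT hc hAT => ?_
    rcases hswap σ T c hT hc hAT with h | h
    · exact h.1
    have l1 := finrank_eigenspace_le hAT hT (a := a)
    have l2 := finrank_eigenspace_le hAT hT (a := b)
    rw [h.1] at l1
    rw [h.2] at l2
    have hle : LinearMap.range (A - algebraMap K _ b) ≤ eigenspace A a := by
      rw [eigenspace_def, LinearMap.range_le_ker_iff]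
      exact hP0
    have l3 := Submodule.finrank_mono hle
    have l4 := (A - algebraMap K _ b).finrank_range_add_finrank_ker
    have e : LinearMap.ker (A - algebraMap K _ b) = eigenspace A b := eigenspace_def.symm
    rw [e] at l4
    omega
  -- The kernel of `P` contains both eigenspaces, so `P` has rank 1. As `P` is symmetric in `a` and
  -- `b`, its range is preserved even by a swap.
  · refine exists_isCanonicalLine_of_finrank_eq_one (LinearMap.range P) ?_ ?_
    · have h3 : 1 ≤ finrank K (LinearMap.range P) := by
        rwa [Submodule.one_le_finrank_iff, Ne, LinearMap.range_eq_bot]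
      have h4 : eigenspace A a ⊔ eigenspace A b ≤ LinearMap.ker P := by
        refine sup_le ?_ ?_
        · rw [hcomm, eigenspace_def]
          exact LinearMap.ker_le_ker_comp _ _
        · rw [eigenspace_def]
          exact LinearMap.ker_le_ker_comp _ _
      have h5 := Submodule.finrank_mono h4
      have h6 := Submodule.finrank_sup_add_finrank_inf_eq (eigenspace A a) (eigenspace A b)
      rw [hdisj.eq_bot, finrank_bot] at h6
      have h7 := P.finrank_range_add_finrank_ker
      omega
    · rintro σ T c hT hc hAT _ ⟨u, rfl⟩
      rw [hP, Module.End.mul_apply, map_sub_algebraMap_apply hAT hc,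
        map_sub_algebraMap_apply hAT hc]
      rcases hswap σ T c hT hc hAT with ⟨e1, e2⟩ | ⟨e1, e2⟩
      · rw [e1, e2, ← map_smul, ← Module.End.mul_apply]
        exact ⟨_, rfl⟩
      · rw [e1, e2, ← map_smul, ← Module.End.mul_apply, ← hcomm]
        exact ⟨_, rfl⟩

end Semilinear

/-! ### Rational points of `ℙⁿ` and homogeneous coordinates -/

noncomputable section

namespace SeveriBrauer

open MvPolynomial HomogeneousLocalization

attribute [local instance] MvPolynomial.gradedAlgebra

/-- The grading of the homogeneous coordinate ring of `ℙⁿ`. -/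
abbrev grading (n : ℕ) (K : Type u) [Field K] :
    ℕ → Submodule K (MvPolynomial (Fin (n + 1)) K) :=
  homogeneousSubmodule (Fin (n + 1)) K

variable {n : ℕ} {K : Type u} [Field K]

/-- The constants in the ring of functions on `D₊(g)`. -/
def awayConst (g : MvPolynomial (Fin (n + 1)) K) : K →+* Away (grading n K) g :=
  (fromZeroRingHom (grading n K) (Submonoid.powers g)).comp (algebraMap K (grading n K 0))

lemma val_awayConst (g : MvPolynomial (Fin (n + 1)) K) (c : K) :
    (awayConst g c).val =
      algebraMap (MvPolynomial (Fin (n + 1)) K) (Localization.Away g) (C c) := by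
  change Localization.mk (C c) 1 = _
  rw [Localization.mk_one_eq_algebraMap]

/-- The evaluation of a function on `D₊(g)` at (the point with homogeneous coordinates) `v`. -/
def evalAway (v : Fin (n + 1) → K) (g : MvPolynomial (Fin (n + 1)) K) (hg : eval v g ≠ 0) :
    Away (grading n K) g →+* K :=
  (IsLocalization.Away.lift (S := Localization.Away g) g (g := eval v)
      (isUnit_iff_ne_zero.2 hg)).comp
    (algebraMap (Away (grading n K) g) (Localization.Away g))

lemma evalAway_awayConst {v : Fin (n + 1) → K} {g : MvPolynomial (Fin (n + 1)) K}
    (hg : eval v g ≠ 0) (c : K) : evalAway v g hg (awayConst g c) = c := by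
  rw [evalAway, RingHom.comp_apply, HomogeneousLocalization.algebraMap_apply, val_awayConst,
    IsLocalization.Away.lift_eq,
    eval_C]

lemma evalAway_mk {v : Fin (n + 1) → K} {g : MvPolynomial (Fin (n + 1)) K}
    (hg : eval v g ≠ 0) {d : ℕ} (hd : g ∈ grading n K d) (m : ℕ)
    (F : MvPolynomial (Fin (n + 1)) K) (hF : F ∈ grading n K (m • d)) :
    evalAway v g hg (Away.mk _ hd m F hF) = eval v F / eval v g ^ m := by
  rw [eq_div_iff (pow_ne_zero _ hg), evalAway, RingHom.comp_apply,
    HomogeneousLocalization.algebraMap_apply, Away.val_mk,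
    ← map_pow, ← IsLocalization.Away.lift_eq (S := Localization.Away g) g
      (isUnit_iff_ne_zero.2 hg) (g ^ m), ← map_mul, ← Localization.mk_one_eq_algebraMap,
    Localization.mk_mul]
  have : Localization.mk (F * g ^ m) ((⟨g ^ m, m, rfl⟩ : Submonoid.powers g) * 1) =
      algebraMap _ (Localization.Away g) F := by
    rw [← Localization.mk_one_eq_algebraMap, Localization.mk_eq_mk_iff, Localization.r_iff_exists]
    exact ⟨1, by simp [mul_comm]⟩
  rw [this, IsLocalization.Away.lift_eq]

lemma X_mem (i : Fin (n + 1)) : (X i : MvPolynomial (Fin (n + 1)) K) ∈ grading n K 1 :=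
  isHomogeneous_X K i

/-- The affine coordinate `xⱼ / xᵢ` on `D₊(xᵢ)`. -/
def affineCoord (i j : Fin (n + 1)) : Away (grading n K) (X i : MvPolynomial (Fin (n + 1)) K) :=
  Away.mk _ (X_mem i) 1 (X j) (X_mem j)

lemma evalAway_affineCoord {v : Fin (n + 1) → K} {i : Fin (n + 1)}
    (hi : eval v (X i) ≠ 0) (j : Fin (n + 1)) :
    evalAway v (X i) hi (affineCoord i j) = v j / v i := by
  rw [affineCoord, evalAway_mk]; simp

lemma affineCoord_self (i : Fin (n + 1)) : affineCoord (K := K) i i = 1 := by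
  ext
  rw [affineCoord, Away.val_mk, val_one, Localization.mk_eq_mk', IsLocalization.mk'_eq_iff_eq_mul]
  simp

lemma _root_.MvPolynomial.IsHomogeneous.eval₂_mul {σ R S : Type*} [CommSemiring R]
    [CommSemiring S] {p : MvPolynomial σ R} {m : ℕ} (hp : p.IsHomogeneous m) (f : R →+* S) (c : S)
    (y : σ → S) : eval₂ f (fun i => c * y i) p = c ^ m * eval₂ f y p := by
  rw [eval₂_eq, eval₂_eq, Finset.mul_sum]
  refine Finset.sum_congr rfl fun s hs => ?_
  rw [hp.degree_eq_sum_deg_support hs, ← Finset.prod_pow_eq_pow_sum]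
  simp only [mul_pow, Finset.prod_mul_distrib]
  ring

/-- The ring of functions on `D₊(xᵢ)` is generated by the affine coordinates. -/
lemma away_mk_eq_eval₂ (i : Fin (n + 1)) (m : ℕ) (F : MvPolynomial (Fin (n + 1)) K)
    (hF : F ∈ grading n K (m • 1)) :
    Away.mk _ (X_mem i) m F hF = eval₂ (awayConst (X i)) (affineCoord i) F := by
  apply val_injective
  have e : ∀ a, val a = algebraMap (Away (grading n K) (X i : MvPolynomial (Fin (n + 1)) K))
    (Localization.Away (X i : MvPolynomial (Fin (n + 1)) K)) a := fun _ => rfl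
  rw [e (eval₂ _ _ _), hom_eval₂]
  have h1 : (algebraMap (Away (grading n K) (X i : MvPolynomial (Fin (n + 1)) K))
    (Localization.Away (X i : MvPolynomial (Fin (n + 1)) K))).comp (awayConst (X i)) =
      (algebraMap (MvPolynomial (Fin (n + 1)) K) _).comp C := by
    ext c; exact val_awayConst _ _
  -- Each affine coordinate is `xᵢ⁻¹ * xⱼ`, and homogeneity of `F` pulls out the factor `xᵢ⁻¹ ^ m`.
  have h2 : (fun j => algebraMap (Away (grading n K) (X i : MvPolynomial (Fin (n + 1)) K))
    (Localization.Away (X i : MvPolynomial (Fin (n + 1)) K)) (affineCoord i j)) =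
      fun j => Localization.mk 1 (⟨X i, 1, pow_one _⟩ : Submonoid.powers _) *
        algebraMap (MvPolynomial (Fin (n + 1)) K) _ (X j) := by
    ext j
    rw [← Localization.mk_one_eq_algebraMap, Localization.mk_mul]
    change Localization.mk _ _ = _
    simp
  have h3 : m • 1 = m := by simp
  rw [h3] at hF
  have h4 : eval₂ ((algebraMap (MvPolynomial (Fin (n + 1)) K)
      (Localization.Away (X i : MvPolynomial (Fin (n + 1)) K))).comp C)
      (fun j => algebraMap (MvPolynomial (Fin (n + 1)) K) _ (X j)) F = algebraMap _ _ F := by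
    rw [← hom_eval₂, eval₂_eta]
  rw [h1]
  change _ = eval₂ _ (fun j => algebraMap
    (Away (grading n K) (X i : MvPolynomial (Fin (n + 1)) K)) _ (affineCoord i j)) F
  rw [h2, IsHomogeneous.eval₂_mul hF, h4, Localization.mk_pow, ← Localization.mk_one_eq_algebraMap,
    Localization.mk_mul, Away.val_mk]
  simp
  rfl

lemma away_hom_ext {L : Type*} [CommRing L] {i : Fin (n + 1)}
    {φ ψ : Away (grading n K) (X i : MvPolynomial (Fin (n + 1)) K) →+* L}
    (h : ∀ c, φ (awayConst _ c) = ψ (awayConst _ c))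
    (h' : ∀ j, φ (affineCoord i j) = ψ (affineCoord i j)) : φ = ψ := by
  ext z
  obtain ⟨m, F, hF, rfl⟩ := Away.mk_surjective _ (X_mem i) z
  rw [away_mk_eq_eval₂, hom_eval₂, hom_eval₂]
  congr 1
  · ext c; exact h c
  · ext j; exact h' j

lemma evalAway_comp_awayMap {v : Fin (n + 1) → K} {f g h : MvPolynomial (Fin (n + 1)) K}
    {d e : ℕ} (hd : f ∈ grading n K d) (he : g ∈ grading n K e) (hh : h = f * g)
    (hf : eval v f ≠ 0) (hv : eval v h ≠ 0) :
    (evalAway v h hv).comp (awayMap _ he hh) = evalAway v f hf := by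
  ext z
  obtain ⟨m, F, hF, rfl⟩ := Away.mk_surjective _ hd z
  have hg : eval v g ≠ 0 := by
    rintro hg; simp [hh, hg] at hv
  rw [RingHom.comp_apply, awayMap_mk, evalAway_mk, evalAway_mk]
  subst hh
  simp only [map_mul, map_pow, mul_pow]
  field_simp

/-- The morphism `Spec K ⟶ ℙⁿ` given by evaluation at `v` on the chart `D₊(g)`. -/
def chartPoint (v : Fin (n + 1) → K) (g : MvPolynomial (Fin (n + 1)) K) (hg : eval v g ≠ 0)
    {d : ℕ} (hd : g ∈ grading n K d) (hd0 : 0 < d) : Spec (.of K) ⟶ Proj (grading n K) :=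
  Spec.map (CommRingCat.ofHom (evalAway v g hg)) ≫ Proj.awayι (grading n K) g hd hd0

lemma chartPoint_mul {v : Fin (n + 1) → K} {f g h : MvPolynomial (Fin (n + 1)) K}
    {d e l : ℕ} (hd : f ∈ grading n K d) (he : g ∈ grading n K e) (hl : h ∈ grading n K l)
    (hh : h = f * g) (hf : eval v f ≠ 0) (hv : eval v h ≠ 0) (hd0 : 0 < d) (hl0 : 0 < l) :
    chartPoint v h hv hl hl0 = chartPoint v f hf hd hd0 := by
  have h0 : h ≠ 0 := by rintro rfl; simp at hv
  obtain rfl : l = d + e := IsHomogeneous.inj_right hl (hh ▸ IsHomogeneous.mul hd he) h0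
  rw [chartPoint, chartPoint, ← Proj.SpecMap_awayMap_awayι (grading n K) hd hd0 he hh,
    ← Category.assoc, ← Spec.map_comp, ← CommRingCat.ofHom_comp, evalAway_comp_awayMap hd he hh hf]

/-- Both charts are compared with `D₊(f * g)`. Hence `projPoint` does not depend on the chosen
nonzero coordinate. -/
lemma chartPoint_eq {v : Fin (n + 1) → K} {f g : MvPolynomial (Fin (n + 1)) K}
    {d e : ℕ} (hd : f ∈ grading n K d) (he : g ∈ grading n K e)
    (hf : eval v f ≠ 0) (hg : eval v g ≠ 0) (hd0 : 0 < d) (he0 : 0 < e) :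
    chartPoint v f hf hd hd0 = chartPoint v g hg he he0 := by
  have h : eval v (f * g) ≠ 0 := by rw [map_mul]; exact mul_ne_zero hf hg
  rw [← chartPoint_mul hd he (IsHomogeneous.mul hd he) rfl hf h hd0 (by omega),
    ← chartPoint_mul he hd (IsHomogeneous.mul hd he) (mul_comm _ _) hg h he0 (by omega)]

/-- The `K`-point of `ℙⁿ` with homogeneous coordinates `v`. -/
def projPoint (v : Fin (n + 1) → K) (hv : v ≠ 0) : Spec (.of K) ⟶ Proj (grading n K) :=
  chartPoint v (X (Function.ne_iff.1 hv).choose)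
    (by simpa using (Function.ne_iff.1 hv).choose_spec) (X_mem _) one_pos

lemma projPoint_eq_chartPoint {v : Fin (n + 1) → K} (hv : v ≠ 0)
    {g : MvPolynomial (Fin (n + 1)) K} (hg : eval v g ≠ 0) {d : ℕ} (hd : g ∈ grading n K d)
    (hd0 : 0 < d) : projPoint v hv = chartPoint v g hg hd hd0 :=
  chartPoint_eq _ _ _ _ _ _

/-- The unique point of `Spec K`. -/
def specPoint (K : Type u) [Field K] : Spec (.of K) := IsLocalRing.closedPoint K

instance : Subsingleton (Spec (.of K)) := inferInstanceAs (Subsingleton (PrimeSpectrum K))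

/-- The structure morphism of `ℙⁿ`. -/
def projStructure (n : ℕ) (K : Type u) [Field K] : Proj (grading n K) ⟶ Spec (.of K) :=
  (projectiveSpace n K).hom

lemma awayι_projStructure (g : MvPolynomial (Fin (n + 1)) K) {d : ℕ} (hd : g ∈ grading n K d)
    (hd0 : 0 < d) : Proj.awayι (grading n K) g hd hd0 ≫ projStructure n K =
      Spec.map (CommRingCat.ofHom (awayConst g)) := by
  change _ ≫ (Proj.toSpecZero _ ≫ _) = _
  rw [Proj.awayι_toSpecZero_assoc, ← Spec.map_comp]
  rfl

lemma projPoint_projStructure (v : Fin (n + 1) → K) (hv : v ≠ 0) :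
    projPoint v hv ≫ projStructure n K = 𝟙 _ := by
  rw [projPoint, chartPoint, Category.assoc, awayι_projStructure, ← Spec.map_comp,
    ← CommRingCat.ofHom_comp, ← Spec.map_id]
  congr 1
  ext c
  exact evalAway_awayConst (by simpa using (Function.ne_iff.1 hv).choose_spec) c

lemma exists_mem_basicOpen_X (x : Proj (grading n K)) :
    ∃ i, x ∈ Proj.basicOpen (grading n K) (X i) := by
  have h := Proj.iSup_basicOpen_eq_top' (grading n K) (fun i => X i) (fun i => ⟨1, X_mem i⟩) (by
    rw [eq_top_iff]
    intro p _
    induction p using MvPolynomial.induction_on with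
    | C c => exact Subalgebra.algebraMap_mem _ (⟨C c, isHomogeneous_C _ c⟩ : grading n K 0)
    | add p q hp hq => exact add_mem (hp trivial) (hq trivial)
    | mul_X p i hp => exact mul_mem (hp trivial) (Algebra.subset_adjoin ⟨i, rfl⟩))
  have hx : x ∈ (⊤ : (Proj (grading n K)).Opens) := trivial
  rw [← h] at hx
  simpa using hx

/-- A morphism from a local affine scheme whose closed point lands in a chart factors through
this chart. -/
lemma exists_eq_SpecMap_comp_awayι {R : Type u} [CommRing R]
    {q : Spec (.of R) ⟶ Proj (grading n K)} {g : MvPolynomial (Fin (n + 1)) K} {d : ℕ}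
    (hd : g ∈ grading n K d) (hd0 : 0 < d)
    (h : Set.range q ⊆ Proj.basicOpen (grading n K) g) :
    ∃ φ : Away (grading n K) g →+* R,
      q = Spec.map (CommRingCat.ofHom φ) ≫ Proj.awayι (grading n K) g hd hd0 := by
  have h' : Set.range q ⊆ Set.range (Proj.awayι (grading n K) g hd hd0) := by
    rw [← Scheme.Hom.coe_opensRange (Proj.awayι (grading n K) g hd hd0), Proj.opensRange_awayι]
    exact h
  refine ⟨(Spec.preimage (IsOpenImmersion.lift (Proj.awayι (grading n K) g hd hd0) q h')).hom, ?_⟩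
  rw [CommRingCat.ofHom_hom, Spec.map_preimage, IsOpenImmersion.lift_fac]

/-- The coordinates are the values of `xⱼ / xᵢ` in a chart containing the point; the `i`-th one is
1, so the vector is nonzero. -/
lemma exists_eq_projPoint (q : Spec (.of K) ⟶ Proj (grading n K))
    (hq : q ≫ projStructure n K = 𝟙 _) : ∃ v hv, q = projPoint v hv := by
  obtain ⟨i, hi⟩ := exists_mem_basicOpen_X (q (specPoint K))
  obtain ⟨φ, hφ⟩ := exists_eq_SpecMap_comp_awayι (q := q) (X_mem i) one_pos (by
    rintro _ ⟨z, rfl⟩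
    rwa [Subsingleton.elim z (specPoint K)])
  have hconst : ∀ c, φ (awayConst _ c) = c := by
    intro c
    rw [hφ, Category.assoc, awayι_projStructure, ← Spec.map_comp, ← CommRingCat.ofHom_comp,
      ← Spec.map_id] at hq
    exact congrArg (fun f => f.hom c) (Spec.map_injective hq)
  have hvi : φ (affineCoord i i) = 1 := by rw [affineCoord_self, map_one]
  have hv : (fun j => φ (affineCoord i j)) ≠ 0 := fun h => by
    have := congrFun h i
    simp [hvi] at this
  have hvi' : eval (fun j => φ (affineCoord i j)) (X i) ≠ 0 := by simp [hvi]
  refine ⟨_, hv, ?_⟩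
  rw [hφ, projPoint_eq_chartPoint hv hvi' (X_mem i) one_pos, chartPoint]
  congr 3
  refine away_hom_ext (fun c => ?_) fun j => ?_
  · rw [hconst, evalAway_awayConst]
  · rw [evalAway_affineCoord, hvi, div_one]

lemma projPoint_mem_basicOpen {v : Fin (n + 1) → K} (hv : v ≠ 0)
    {g : MvPolynomial (Fin (n + 1)) K} {d : ℕ} (hd : g ∈ grading n K d) (hd0 : 0 < d) :
    projPoint v hv (specPoint K) ∈ Proj.basicOpen (grading n K) g ↔
      eval v g ≠ 0 := by
  obtain ⟨i, hi⟩ := Function.ne_iff.1 hv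
  simp only [Pi.zero_apply] at hi
  have hi' : eval v (X i) ≠ 0 := by simpa using hi
  rw [projPoint_eq_chartPoint hv hi' (X_mem i) one_pos, chartPoint, Scheme.Hom.comp_apply]
  change Spec.map (CommRingCat.ofHom (evalAway v (X i) hi')) (specPoint K) ∈
    Proj.awayι (grading n K) (X i) (X_mem i) one_pos ⁻¹ᵁ Proj.basicOpen (grading n K) g ↔ _
  rw [Proj.awayι_preimage_basicOpen (grading n K) (X_mem i) one_pos hd hd0]
  change ¬ (evalAway v (X i) hi' (Away.isLocalizationElem (X_mem i) hd) ∈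
    IsLocalRing.maximalIdeal K) ↔ _
  rw [IsLocalRing.mem_maximalIdeal, mem_nonunits_iff, isUnit_iff_ne_zero, evalAway_mk]
  simp [hi, hd0.ne']

lemma projPoint_eq_iff {v w : Fin (n + 1) → K} (hv : v ≠ 0) (hw : w ≠ 0) :
    projPoint v hv = projPoint w hw ↔ Proportional v w := by
  obtain ⟨i, hi⟩ := Function.ne_iff.1 hv
  simp only [Pi.zero_apply] at hi
  have hi' : eval v (X i) ≠ 0 := by simpa using hi
  constructor
  · intro h
    have h1 := (projPoint_mem_basicOpen hv (X_mem i) one_pos).2 hi'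
    rw [h, projPoint_mem_basicOpen hw (X_mem i) one_pos] at h1
    rw [projPoint_eq_chartPoint hv hi' (X_mem i) one_pos,
      projPoint_eq_chartPoint hw h1 (X_mem i) one_pos, chartPoint, chartPoint, cancel_mono] at h
    have h2 : evalAway v (X i) hi' = evalAway w (X i) h1 :=
      congrArg CommRingCat.Hom.hom (Spec.map_injective h)
    simp only [eval_X] at h1
    have h3 : w = (w i / v i) • v := by
      ext j
      have := congrArg (fun f => f (affineCoord i j)) h2
      simp only [evalAway_affineCoord] at this
      simp only [Pi.smul_apply, smul_eq_mul]
      field_simp at this ⊢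
      linear_combination -this
    rw [h3]
    exact Proportional.smul_right _ _
  · intro h
    obtain ⟨c, hc, rfl⟩ := h.exists_smul_ne hv hw
    have h1 : eval (c • v) (X i) ≠ 0 := by simp [hc, hi]
    rw [projPoint_eq_chartPoint hv hi' (X_mem i) one_pos,
      projPoint_eq_chartPoint hw h1 (X_mem i) one_pos, chartPoint, chartPoint]
    congr 3
    refine away_hom_ext (fun a => ?_) fun j => ?_
    · rw [evalAway_awayConst, evalAway_awayConst]
    · rw [evalAway_affineCoord, evalAway_affineCoord]
      simp only [Pi.smul_apply, smul_eq_mul]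
      field_simp

end SeveriBrauer

end

/-! ### Semilinear automorphisms of `ℙⁿ` in coordinates -/

noncomputable section

namespace SeveriBrauer

open MvPolynomial HomogeneousLocalization

attribute [local instance] MvPolynomial.gradedAlgebra

variable {n : ℕ} {K : Type u} [Field K]

/-- The morphism of `Spec K` induced by an automorphism of `K`. -/
def specMap (τ : K ≃+* K) : Spec (.of K) ⟶ Spec (.of K) :=
  Spec.map (CommRingCat.ofHom (τ : K →+* K))

@[simp]
lemma specMap_symm_comp (τ : K ≃+* K) : specMap τ.symm ≫ specMap τ = 𝟙 _ := by
  rw [specMap, specMap, ← Spec.map_comp, ← CommRingCat.ofHom_comp, ← Spec.map_id]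
  congr 1
  ext c
  exact τ.symm_apply_apply c

@[simp]
lemma specMap_comp_symm (τ : K ≃+* K) : specMap τ ≫ specMap τ.symm = 𝟙 _ :=
  specMap_symm_comp τ.symm

/-- The preimage of a chart contains a homogeneous basic open neighbourhood of any given point. -/
lemma exists_basicOpen_le (U : (Proj (grading n K)).Opens) (v : Fin (n + 1) → K) (hv : v ≠ 0)
    (h : projPoint v hv (specPoint K) ∈ U) :
    ∃ (g : MvPolynomial (Fin (n + 1)) K) (d : ℕ), g ∈ grading n K d ∧ 0 < d ∧ eval v g ≠ 0 ∧
      Proj.basicOpen (grading n K) g ≤ U := by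
  obtain ⟨_, ⟨f, rfl⟩, hf, hfU⟩ := TopologicalSpace.Opens.isBasis_iff_nbhd.1
    (Proj.isBasis_basicOpen (grading n K)) h
  rw [Proj.basicOpen_eq_iSup_proj, TopologicalSpace.Opens.mem_iSup] at hf
  obtain ⟨d, hd⟩ := hf
  obtain ⟨i, hi⟩ := Function.ne_iff.1 hv
  simp only [Pi.zero_apply] at hi
  -- The component of `f` may have degree 0; multiplying by a variable that does not vanish at `v`
  -- makes the degree positive.
  have hmem : X i * GradedRing.proj (grading n K) d f ∈ grading n K (1 + d) :=
    (X_mem i).mul (SetLike.coe_mem (DirectSum.decompose (grading n K) f d))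
  refine ⟨_, _, hmem, by omega, ?_, ?_⟩
  · rw [← projPoint_mem_basicOpen hv hmem (by omega), Proj.basicOpen_mul]
    exact ⟨(projPoint_mem_basicOpen hv (X_mem i) one_pos).2 (by simpa using hi), hd⟩
  · refine le_trans ?_ hfU
    rw [Proj.basicOpen_mul, Proj.basicOpen_eq_iSup_proj (grading n K) f]
    exact inf_le_right.trans (le_iSup (fun i => Proj.basicOpen (grading n K)
      (GradedRing.proj (grading n K) i f)) d)

/-- Finitely many functions on `D₊(g)` have a common denominator. -/
lemma exists_common_denominator {g : MvPolynomial (Fin (n + 1)) K} {d : ℕ}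
    (hd : g ∈ grading n K d) {ι : Type*} [Fintype ι] (z : ι → Away (grading n K) g) :
    ∃ (m : ℕ) (F : ι → MvPolynomial (Fin (n + 1)) K), (∀ i, (F i).IsHomogeneous (m * d)) ∧
      ∀ (i : ι) (w : Fin (n + 1) → K) (hw : eval w g ≠ 0),
        evalAway w g hw (z i) = eval w (F i) / eval w g ^ m := by
  choose m F hF hz using fun i => Away.mk_surjective _ hd (z i)
  have hle : ∀ i, m i ≤ ∑ j, m j := fun i =>
    Finset.single_le_sum (f := m) (fun _ _ => Nat.zero_le _) (Finset.mem_univ i)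
  refine ⟨∑ j, m j, fun i => F i * g ^ (∑ j, m j - m i), fun i => ?_, fun i w hw => ?_⟩
  · have h := IsHomogeneous.mul (hF i) (IsHomogeneous.pow hd (∑ j, m j - m i))
    convert h using 1
    rw [smul_eq_mul, mul_comm d, ← add_mul, Nat.add_sub_cancel' (hle i)]
  · rw [← hz, evalAway_mk, map_mul, map_pow, div_eq_div_iff (pow_ne_zero _ hw) (pow_ne_zero _ hw),
      mul_assoc, ← pow_add, Nat.sub_add_cancel (hle i)]

/-- A `τ`-semilinear endomorphism of `ℙⁿ` is locally given by homogeneous polynomials. -/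
theorem exists_local_expression (τ : K ≃+* K) (f : Proj (grading n K) ⟶ Proj (grading n K))
    (hf : f ≫ projStructure n K = projStructure n K ≫ specMap τ)
    (v : Fin (n + 1) → K) (hv : v ≠ 0) :
    ∃ (d : ℕ) (F : Fin (n + 1) → MvPolynomial (Fin (n + 1)) K) (g : MvPolynomial (Fin (n + 1)) K),
      (∀ i, (F i).IsHomogeneous d) ∧ eval v g ≠ 0 ∧ ∀ w (hw : w ≠ 0), eval w g ≠ 0 →
        (fun i => eval w (F i)) ≠ 0 ∧ ∀ u (hu : u ≠ 0), (∀ i, τ (u i) = eval w (F i)) →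
          specMap τ.symm ≫ projPoint w hw ≫ f = projPoint u hu := by
  obtain ⟨i, hi⟩ := exists_mem_basicOpen_X (f (projPoint v hv (specPoint K)))
  obtain ⟨g, d, hd, hd0, hg, hU⟩ := exists_basicOpen_le
    (f ⁻¹ᵁ Proj.basicOpen (grading n K) (X i)) v hv hi
  obtain ⟨φ, hφ⟩ := exists_eq_SpecMap_comp_awayι
    (q := Proj.awayι (grading n K) g hd hd0 ≫ f) (X_mem i) one_pos (by
      rintro _ ⟨z, rfl⟩
      refine hU ?_
      rw [← Proj.opensRange_awayι (grading n K) g hd hd0]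
      exact ⟨z, rfl⟩)
  have hconst : ∀ c, φ (awayConst _ c) = awayConst _ (τ c) := by
    intro c
    have h := congrArg (· ≫ projStructure n K) hφ
    simp only [Category.assoc] at h
    rw [hf, awayι_projStructure, ← Category.assoc, awayι_projStructure, specMap, ← Spec.map_comp,
      ← Spec.map_comp] at h
    exact (congrArg (fun f => f.hom c) (Spec.map_injective h)).symm
  obtain ⟨m, F, hF, hFφ⟩ := exists_common_denominator hd fun j => φ (affineCoord i j)
  refine ⟨_, F, g, hF, hg, fun w hw hgw => ?_⟩
  -- `xᵢ / xᵢ = 1` forces `F i` to take the value of the common denominator, so `F` has no zero on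
  -- `D₊(g)`.
  have hFi : eval w (F i) = eval w g ^ m := by
    have h := hFφ i w hgw
    rw [affineCoord_self, map_one, map_one, eq_div_iff (pow_ne_zero _ hgw), one_mul] at h
    exact h.symm
  have hFi0 : eval w (F i) ≠ 0 := hFi ▸ pow_ne_zero _ hgw
  refine ⟨fun h => hFi0 (congrFun h i), fun u hu hτu => ?_⟩
  have hui : eval u (X i) ≠ 0 := fun h => hFi0 (by
    rw [eval_X] at h
    rw [← hτu, h, map_zero])
  rw [projPoint_eq_chartPoint hw hgw hd hd0, projPoint_eq_chartPoint hu hui (X_mem i) one_pos,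
    chartPoint, chartPoint, Category.assoc, hφ, specMap, ← Spec.map_comp_assoc,
    ← Spec.map_comp_assoc]
  congr 2
  rw [← CommRingCat.ofHom_comp, ← CommRingCat.ofHom_comp]
  congr 1
  refine away_hom_ext (fun c => ?_) fun j => ?_
  · simp only [RingHom.comp_apply, hconst, evalAway_awayConst]
    exact τ.symm_apply_apply c
  · simp only [RingHom.comp_apply, hFφ, evalAway_affineCoord]
    refine τ.injective ?_
    rw [map_div₀ τ (u j), hτu, hτu, hFi]
    exact τ.apply_symm_apply _

/-- Semilinear automorphisms of `ℙⁿ` over an algebraically closed field act on points by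
semilinear maps. -/
theorem exists_linearMap_of_iso [IsAlgClosed K] [NeZero n] (τ : K ≃+* K)
    (f : Proj (grading n K) ≅ Proj (grading n K))
    (hf : f.hom ≫ projStructure n K = projStructure n K ≫ specMap τ) :
    ∃ A : (Fin (n + 1) → K) →ₗ[K] Fin (n + 1) → K, ∀ v (hv : v ≠ 0), A v ≠ 0 ∧
      ∀ u (hu : u ≠ 0), (∀ i, τ (u i) = A v i) →
        specMap τ.symm ≫ projPoint v hv ≫ f.hom = projPoint u hu := by
  have hf' : f.inv ≫ projStructure n K = projStructure n K ≫ specMap τ.symm := by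
    rw [Iso.inv_comp_eq, ← Category.assoc, hf, Category.assoc, specMap_comp_symm, Category.comp_id]
  have hsec : ∀ (τ : K ≃+* K) (f : Proj (grading n K) ⟶ Proj (grading n K))
      (hf : f ≫ projStructure n K = projStructure n K ≫ specMap τ) (v : Fin (n + 1) → K),
      ∃ u, ∀ hv : v ≠ 0, ∃ hu : u ≠ 0, specMap τ.symm ≫ projPoint v hv ≫ f = projPoint u hu := by
    intro τ f hf v
    by_cases hv : v = 0
    · exact ⟨0, fun h => absurd hv h⟩
    · obtain ⟨u, hu, h⟩ := exists_eq_projPoint (specMap τ.symm ≫ projPoint v hv ≫ f) (by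
        rw [Category.assoc, Category.assoc, hf, ← Category.assoc (projPoint v hv),
          projPoint_projStructure, Category.id_comp, specMap_symm_comp])
      exact ⟨u, fun _ => ⟨hu, h⟩⟩
  choose P hP using hsec τ f.hom hf
  choose Q hQ using hsec τ.symm f.inv hf'
  have hreg : ∀ (τ : K ≃+* K) (f : Proj (grading n K) ⟶ Proj (grading n K))
      (_ : f ≫ projStructure n K = projStructure n K ≫ specMap τ)
      (P : (Fin (n + 1) → K) → Fin (n + 1) → K)
      (_ : ∀ v (hv : v ≠ 0), ∃ hu : P v ≠ 0, specMap τ.symm ≫ projPoint v hv ≫ f =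
        projPoint (P v) hu), IsRegularMap (fun v => τ ∘ P v) := by
    intro τ f hf P hP v hv
    obtain ⟨d, F, g, hF, hg, h⟩ := exists_local_expression τ f hf v hv
    refine ⟨d, F, g, hF, hg, fun w hw hgw => ?_⟩
    obtain ⟨h0, h1⟩ := h w hw hgw
    refine ⟨h0, ?_⟩
    have hu : (fun i => τ.symm (eval w (F i))) ≠ 0 := fun h => h0 (funext fun i => by
      have := congrFun h i
      simpa using this)
    obtain ⟨h2, h3⟩ := hP w hw
    rw [h1 _ hu fun i => τ.apply_symm_apply _, projPoint_eq_iff] at h3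
    have := h3.map (τ : K →+* K)
    intro i j
    simpa using this i j
  have h0 : ∀ (τ : K ≃+* K) (v : Fin (n + 1) → K), v ≠ 0 → τ ∘ v ≠ 0 := by
    intro τ v hv h
    exact hv (funext fun i => τ.injective (by simpa using congrFun h i))
  have hsymm : ∀ v : Fin (n + 1) → K, τ ∘ τ.symm ∘ v = v := fun v => by ext; simp
  have hsymm' : ∀ v : Fin (n + 1) → K, τ.symm ∘ τ ∘ v = v := fun v => by ext; simp
  -- Conjugating by `τ` turns the regular map of the inverse into `v ↦ Q (τ.symm ∘ v)`, which undoes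
  -- `τ ∘ P` up to scalars.
  have hQreg := (hreg τ.symm f.inv hf' Q hQ).conj τ
  simp only [hsymm] at hQreg
  obtain ⟨A, hA⟩ := (hreg τ f.hom hf P hP).exists_linearMap hQreg
    (fun v hv => h0 τ _ (hP v hv).1) (fun v hv => (hQ _ (h0 τ.symm v hv)).1) (by
      intro v hv
      rw [hsymm']
      obtain ⟨h1, h2⟩ := hP v hv
      obtain ⟨h3, h4⟩ := hQ _ h1
      rw [← projPoint_eq_iff h3 hv, ← h4, ← h2]
      simp only [Category.assoc, Iso.hom_inv_id, Category.comp_id]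
      change specMap τ ≫ _ = _
      rw [← Category.assoc, specMap_comp_symm, Category.id_comp])
  refine ⟨A, fun v hv => ⟨(hA v hv).1, fun u hu hτu => ?_⟩⟩
  obtain ⟨h1, h2⟩ := hP v hv
  rw [h2, projPoint_eq_iff]
  have h3 := ((hA v hv).2.map (τ.symm : K →+* K)).symm
  change Proportional (τ.symm ∘ τ ∘ P v) (τ.symm ∘ A v) at h3
  rw [hsymm'] at h3
  convert h3
  ext i
  rw [Function.comp_apply, ← hτu, τ.symm_apply_apply]

end SeveriBrauer

end

/-! ### Geometric points, residue fields and the Galois action -/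

noncomputable section

namespace SeveriBrauer

variable {k : Type u} [Field k]

/-- The embeddings of an extension of `k` into `k̄` are conjugate under the Galois group. -/
lemma exists_algEquiv_comp_eq {L K : Type*} [Field L] [Field K] [Algebra k L] [Algebra k K]
    [Normal k K] (φ ψ : L →ₐ[k] K) :
    ∃ τ : K ≃ₐ[k] K, ∀ z, τ (φ z) = ψ z := by
  let e₁ : L ≃ₐ[k] φ.fieldRange := AlgEquiv.ofInjectiveField φ
  let e₂ : L ≃ₐ[k] ψ.fieldRange := AlgEquiv.ofInjectiveField ψ
  refine ⟨(e₁.symm.trans e₂).liftNormal K, fun z => ?_⟩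
  have h := (e₁.symm.trans e₂).liftNormal_commutes K (e₁ z)
  rw [AlgEquiv.trans_apply, AlgEquiv.symm_apply_apply] at h
  exact h

variable {S : Over (Spec (.of k))}

/-- The residue fields of a scheme over `k` are extensions of `k`. -/
instance residueFieldAlgebra (p : S.left) : Algebra k (S.left.residueField p) :=
  (Spec.preimage (S.left.fromSpecResidueField p ≫ S.hom)).hom.toAlgebra

lemma specMap_algebraMap_residueField (p : S.left) :
    Spec.map (CommRingCat.ofHom (algebraMap k (S.left.residueField p))) =
      S.left.fromSpecResidueField p ≫ S.hom :=
  Spec.map_preimage _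

/-- `residueDegree` is taken over the residue field of the image point in `Spec k`. That field is
`k`, because the inclusion of the only point is a surjective closed immersion into a reduced scheme.
-/
lemma residueDegree_eq_finrank (p : S.left) :
    S.hom.residueDegree p = Module.finrank k (S.left.residueField p) := by
  let q : Spec (.of k) := S.hom p
  have : Subsingleton (Spec (.of k)) := inferInstanceAs (Subsingleton (PrimeSpectrum k))
  have : IsClosedImmersion ((Spec (.of k)).fromSpecResidueField q) := by
    rw [← isClosed_singleton_iff_isClosedImmersion,
      ← Set.subsingleton_of_subsingleton.eq_singleton_of_mem (Set.mem_univ q)]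
    exact isClosed_univ
  have : Surjective ((Spec (.of k)).fromSpecResidueField q) :=
    ⟨fun z => ⟨Classical.arbitrary _, Subsingleton.elim _ _⟩⟩
  have hiso : IsIso ((Spec (.of k)).fromSpecResidueField q) :=
    isIso_of_isClosedImmersion_of_surjective _
  let g := Spec.preimage ((Spec (.of k)).fromSpecResidueField q)
  have hg : IsIso (Spec.map g) := by rw [Spec.map_preimage]; exact hiso
  let e : k ≃+* (Spec (.of k)).residueField q := RingEquiv.ofBijective g.hom
    (isIso_SpecMap_iff.1 hg)
  let := (S.hom.residueFieldMap p).hom.toAlgebra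
  change Module.finrank ((Spec (.of k)).residueField q) (S.left.residueField p) = _
  symm
  refine Algebra.finrank_eq_of_equiv_equiv e (RingEquiv.refl _) ?_
  have h : Spec.preimage (S.left.fromSpecResidueField p ≫ S.hom) =
      g ≫ S.hom.residueFieldMap p := by
    apply Spec.map_injective
    rw [Spec.map_preimage, Spec.map_comp, Spec.map_preimage,
      Scheme.Hom.SpecMap_residueFieldMap_fromSpecResidueField]
  ext c
  exact (congrArg (fun f => f.hom c) h).symm

/-- The geometric point given by an embedding of a residue field. -/
def geometricPointOfEmbedding (p : S.left)
    (φ : S.left.residueField p →ₐ[k] AlgebraicClosure k) : GeometricPoint S :=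
  Over.homMk (Spec.map (CommRingCat.ofHom φ.toRingHom) ≫ S.left.fromSpecResidueField p) (by
    change _ = specAlgebraicClosure k
    rw [Category.assoc, ← specMap_algebraMap_residueField, ← Spec.map_comp,
      ← CommRingCat.ofHom_comp, specAlgebraicClosure]
    congr 2
    exact φ.comp_algebraMap)

lemma support_geometricPointOfEmbedding (p : S.left)
    (φ : S.left.residueField p →ₐ[k] AlgebraicClosure k) :
    (geometricPointOfEmbedding p φ).support = p := by
  change (Spec.map (CommRingCat.ofHom φ.toRingHom) ≫ S.left.fromSpecResidueField p)
    (specPoint _) = p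
  rw [Scheme.Hom.comp_apply, Scheme.fromSpecResidueField_apply]

lemma geometricPointOfEmbedding_injective (p : S.left) :
    Function.Injective (geometricPointOfEmbedding p) := by
  intro φ ψ h
  have h1 := congrArg (fun f => f.left) h
  change Spec.map _ ≫ _ = Spec.map _ ≫ _ at h1
  rw [cancel_mono] at h1
  have h2 := congrArg CommRingCat.Hom.hom (Spec.map_injective h1)
  exact AlgHom.coe_ringHom_injective h2

lemma exists_SpecMap_comp_fromSpecResidueField_eq {X : Scheme.{u}} {K : Type u} [Field K]
    (x : Spec (.of K) ⟶ X) : ∃ f : X.residueField (x (specPoint K)) ⟶ .of K,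
      Spec.map f ≫ X.fromSpecResidueField (x (specPoint K)) = x := by
  obtain ⟨⟨p, f⟩, h⟩ := (Scheme.SpecToEquivOfField K X).symm.surjective x
  replace h : Spec.map f ≫ X.fromSpecResidueField p = x := h
  have hp : x (specPoint K) = p := by
    rw [← h, Scheme.Hom.comp_apply, Scheme.fromSpecResidueField_apply]
  subst hp
  exact ⟨f, h⟩

lemma exists_eq_geometricPointOfEmbedding (x : GeometricPoint S) :
    ∃ φ, x = geometricPointOfEmbedding x.support φ := by
  obtain ⟨f, hf⟩ : ∃ f : S.left.residueField x.support ⟶ .of (AlgebraicClosure k),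
      Spec.map f ≫ S.left.fromSpecResidueField x.support = x.left :=
    exists_SpecMap_comp_fromSpecResidueField_eq x.left
  have hx : x.left ≫ S.hom = specAlgebraicClosure k := Over.w x
  refine ⟨{ f.hom with commutes' := fun c => ?_ }, ?_⟩
  · replace hx : Spec.map f ≫ S.left.fromSpecResidueField x.support ≫ S.hom = _ :=
      (Category.assoc _ _ _).symm.trans ((congrArg (· ≫ S.hom) hf).trans hx)
    rw [← specMap_algebraMap_residueField, ← Spec.map_comp] at hx
    exact congrArg (fun f => f.hom c) (Spec.map_injective hx)
  · ext1
    exact hf.symm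

/-- The components of `p` correspond to the embeddings of its residue field into `k̄`. -/
def componentsEquiv (p : S.left) :
    (S.left.residueField p →ₐ[k] AlgebraicClosure k) ≃ components p :=
  Equiv.ofBijective
    (fun φ => ⟨geometricPointOfEmbedding p φ, support_geometricPointOfEmbedding p φ⟩)
    ⟨fun _ _ h => geometricPointOfEmbedding_injective p (congrArg Subtype.val h), by
      rintro ⟨x, rfl⟩
      obtain ⟨φ, hφ⟩ := exists_eq_geometricPointOfEmbedding x
      exact ⟨φ, Subtype.ext hφ.symm⟩⟩

/-- Components are embeddings of the residue field into `k̄`; algebraic extensions of a perfect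
field are separable, so their number is the degree. -/
lemma ncard_components [PerfectField k] (p : S.left)
    [Algebra.IsAlgebraic k (S.left.residueField p)] :
    (components p).ncard = S.hom.residueDegree p := by
  rw [residueDegree_eq_finrank, ← Nat.card_coe_set_eq, ← Nat.card_congr (componentsEquiv p),
    ← Field.finSepDegree_eq_of_isAlgClosed, Field.finSepDegree_eq_finrank_of_isSeparable]

lemma isAlgebraic_residueField_support (x : GeometricPoint S) :
    Algebra.IsAlgebraic k (S.left.residueField x.support) := by
  obtain ⟨φ, -⟩ := exists_eq_geometricPointOfEmbedding x
  exact Algebra.IsAlgebraic.of_injective φ φ.injective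

lemma IsDPoint.isAlgebraic {d : ℕ} [NeZero d] {p : S.left} (hp : IsDPoint d p) :
    Algebra.IsAlgebraic k (S.left.residueField p) := by
  have : Module.Finite k (S.left.residueField p) := by
    apply Module.finite_of_finrank_pos
    rw [← residueDegree_eq_finrank, hp.degree]
    exact Nat.pos_of_neZero d
  infer_instance

lemma IsDPoint.ncard_components [PerfectField k] {d : ℕ} [NeZero d] {p : S.left}
    (hp : IsDPoint d p) : (components p).ncard = d := by
  have := hp.isAlgebraic
  rw [SeveriBrauer.ncard_components, hp.degree]

/-- The action of the Galois group on the geometric points. -/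
def galoisAct (τ : AlgebraicClosure k ≃ₐ[k] AlgebraicClosure k) (x : GeometricPoint S) :
    GeometricPoint S :=
  Over.homMk (specMap (τ : AlgebraicClosure k ≃+* AlgebraicClosure k) ≫ x.left) (by
    have hx : x.left ≫ S.hom = specAlgebraicClosure k := Over.w x
    change _ = specAlgebraicClosure k
    rw [Category.assoc, hx, specAlgebraicClosure, specMap, ← Spec.map_comp,
      ← CommRingCat.ofHom_comp]
    congr 2
    exact τ.toAlgHom.comp_algebraMap)

lemma support_galoisAct (τ : AlgebraicClosure k ≃ₐ[k] AlgebraicClosure k)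
    (x : GeometricPoint S) : (galoisAct τ x).support = x.support := by
  change (specMap _ ≫ x.left) (specPoint _) = x.left (specPoint _)
  rw [Scheme.Hom.comp_apply]
  congr 1
  exact Subsingleton.elim _ _

/-- Both points are embeddings of one residue field, and such embeddings are conjugate since `k̄` is
normal over `k`. -/
lemma exists_galoisAct_eq {x y : GeometricPoint S} (h : x.support = y.support) :
    ∃ τ, galoisAct τ x = y := by
  obtain ⟨φ, hφ⟩ := (componentsEquiv y.support).surjective ⟨x, h⟩
  obtain ⟨ψ, hψ⟩ := (componentsEquiv y.support).surjective ⟨y, rfl⟩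
  have : Normal k (AlgebraicClosure k) := IsAlgClosure.normal k _
  obtain ⟨τ, hτ⟩ := exists_algEquiv_comp_eq φ ψ
  refine ⟨τ, ?_⟩
  replace hφ : geometricPointOfEmbedding _ φ = x := congrArg Subtype.val hφ
  replace hψ : geometricPointOfEmbedding _ ψ = y := congrArg Subtype.val hψ
  rw [← hφ]
  refine Eq.trans ?_ hψ
  ext1
  change specMap _ ≫ Spec.map _ ≫ _ = Spec.map _ ≫ _
  rw [specMap, ← Spec.map_comp_assoc, ← CommRingCat.ofHom_comp]
  congr 3
  ext z
  exact hτ z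

/-- `Spec k̄ ⟶ Spec k` is integral and `S` is separated, so the geometric point is itself an
integral, hence closed, morphism. -/
lemma isClosed_singleton_support [IsSeparated S.hom] (x : GeometricPoint S) :
    IsClosed {x.support} := by
  have hx : x.left ≫ S.hom = specAlgebraicClosure k := Over.w x
  have h1 : IsIntegralHom (specAlgebraicClosure k) := by
    rw [specAlgebraicClosure, IsIntegralHom.SpecMap_iff]
    exact algebraMap_isIntegral_iff.2 inferInstance
  have : IsIntegralHom (x.left ≫ S.hom) := by rw [hx]; exact h1
  have : IsIntegralHom x.left := .of_comp x.left S.hom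
  have h2 := x.left.isClosedMap _ isClosed_univ
  convert h2
  rw [Set.image_univ]
  symm
  refine Set.eq_singleton_iff_unique_mem.2 ⟨⟨_, rfl⟩, ?_⟩
  rintro _ ⟨z, rfl⟩
  exact congrArg x.left (Subsingleton.elim (α := Spec (.of (AlgebraicClosure k))) _ _)

/-- A geometric point fixed by the Galois group comes from a `k`-point. -/
lemma isTrivial_of_galoisAct_eq [PerfectField k] (x : GeometricPoint S)
    (h : ∀ τ, galoisAct τ x = x) : IsTrivial S := by
  -- The components form one Galois orbit, here a single point; so the residue field has degree 1
  -- and is `k`.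
  have hc : components x.support = {x} := by
    refine Set.eq_singleton_iff_unique_mem.2 ⟨rfl, fun y hy => ?_⟩
    obtain ⟨τ, rfl⟩ := exists_galoisAct_eq (x := x) (y := y) hy.symm
    exact h τ
  have := isAlgebraic_residueField_support x
  have h1 := ncard_components x.support
  rw [hc, Set.ncard_singleton, residueDegree_eq_finrank] at h1
  let e := AlgEquiv.ofBijective (Algebra.ofId k (S.left.residueField x.support))
    (Module.Free.bijective_algebraMap_of_finrank_eq_one h1.symm)
  refine ⟨Over.homMk (Spec.map (CommRingCat.ofHom e.symm.toAlgHom.toRingHom) ≫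
    S.left.fromSpecResidueField x.support) ?_⟩
  change _ = 𝟙 _
  rw [Category.assoc, ← specMap_algebraMap_residueField, ← Spec.map_comp,
    ← CommRingCat.ofHom_comp]
  refine Eq.trans ?_ (Spec.map_id _)
  congr 1
  ext c
  exact e.symm.commutes c

end SeveriBrauer

end

/-! ### Transport along the trivialization over `k̄` -/

noncomputable section

namespace SeveriBrauer

open MvPolynomial HomogeneousLocalization

attribute [local instance] MvPolynomial.gradedAlgebra

section

variable {n : ℕ} {K : Type u} [Field K]

lemma algebraMap_grading_zero_bijective :
    Function.Bijective (algebraMap K (grading n K 0)) := by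
  constructor
  · intro a b h
    exact C_injective _ _ (congrArg Subtype.val h)
  · rintro ⟨p, hp⟩
    have hp' : p.IsHomogeneous 0 := hp
    rw [← totalDegree_zero_iff_isHomogeneous, totalDegree_eq_zero_iff_eq_C] at hp'
    exact ⟨_, Subtype.ext hp'.symm⟩

instance : Algebra.FiniteType (grading n K 0) (MvPolynomial (Fin (n + 1)) K) :=
  have : IsScalarTower K (grading n K 0) (MvPolynomial (Fin (n + 1)) K) :=
    ⟨fun a b c => smul_mul_assoc a (b : MvPolynomial (Fin (n + 1)) K) c⟩
  Algebra.FiniteType.of_restrictScalars_finiteType K _ _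

instance : IsSeparated (projStructure n K) := by
  have : IsSeparated (Proj.toSpecZero (grading n K)) := inferInstance
  change IsSeparated (Proj.toSpecZero _ ≫ Spec.map _)
  infer_instance

instance : LocallyOfFiniteType (projStructure n K) := by
  have : LocallyOfFiniteType (Proj.toSpecZero (grading n K)) := inferInstance
  have : IsIso (Spec.map (CommRingCat.ofHom (algebraMap K (grading n K 0)))) :=
    isIso_SpecMap_iff.2 algebraMap_grading_zero_bijective
  change LocallyOfFiniteType (Proj.toSpecZero _ ≫ Spec.map _)
  infer_instance

instance (f : MvPolynomial (Fin (n + 1)) K) : _root_.IsReduced (Away (grading n K) f) :=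
  isReduced_of_injective (algebraMap (Away (grading n K) f) (Localization.Away f))
    (val_injective _)

instance : IsReduced (Proj (grading n K)) := by
  let 𝒰 := (Proj.affineOpenCover (grading n K)).openCover
  have (i : 𝒰.I₀) : IsReduced (𝒰.X i) := by
    change IsReduced (Spec (.of (Away (grading n K) _)))
    infer_instance
  exact .of_openCover _ 𝒰

/-- Over an algebraically closed field, an endomorphism of `ℙⁿ` that fixes all points is the
identity. -/
lemma eq_id_of_projPoint_comp_eq [IsAlgClosed K] (f : Proj (grading n K) ⟶ Proj (grading n K))
    (hf : f ≫ projStructure n K = projStructure n K)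
    (h : ∀ v hv, projPoint v hv ≫ f = projPoint v hv) : f = 𝟙 _ := by
  have : LocallyOfFiniteType (f ≫ projStructure n K) := by rw [hf]; infer_instance
  -- As `ℙⁿ` is reduced, separated and locally of finite type, agreement at closed points suffices,
  -- and these are `K`-points.
  refine ext_of_apply_eq (projStructure n K) Set.univ isOpen_univ.isLocallyClosed dense_univ
    (fun x _ hx => ?_) (by rw [hf, Category.id_comp])
  obtain ⟨v, hv, hq⟩ := exists_eq_projPoint (pointOfClosedPoint (projStructure n K) x hx)
    (pointOfClosedPoint_comp _ _ _)
  have hx' : projPoint v hv (specPoint K) = x := by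
    rw [← hq, pointOfClosedPoint_apply]
  rw [← hx', ← Scheme.Hom.comp_apply, h]
  rfl

end

variable {k : Type u} [Field k] {S : Over (Spec (.of k))}

/-- The isomorphism of a trivialized geometric base change with `ℙⁿ`, on underlying schemes. -/
def trivIso {n : ℕ} (e : geometricBaseChange S ≅ projectiveSpace n (AlgebraicClosure k)) :
    pullback S.hom (specAlgebraicClosure k) ≅ Proj (grading n (AlgebraicClosure k)) :=
  (Over.forget _).mapIso e

variable {n : ℕ} (e : geometricBaseChange S ≅ projectiveSpace n (AlgebraicClosure k))

lemma trivIso_hom_projStructure :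
    (trivIso e).hom ≫ projStructure n (AlgebraicClosure k) = pullback.snd _ _ :=
  Over.w e.hom

lemma trivIso_inv_snd :
    (trivIso e).inv ≫ pullback.snd _ _ = projStructure n (AlgebraicClosure k) :=
  Over.w e.inv

/-- The geometric point of `S` with given homogeneous coordinates. -/
def coordPoint (v : Fin (n + 1) → AlgebraicClosure k) (hv : v ≠ 0) : GeometricPoint S :=
  Over.homMk (projPoint v hv ≫ (trivIso e).inv ≫ pullback.fst _ _) (by
    change _ = specAlgebraicClosure k
    rw [Category.assoc, Category.assoc, pullback.condition,
      ← Category.assoc (trivIso e).inv, trivIso_inv_snd, ← Category.assoc, projPoint_projStructure]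
    exact Category.id_comp _)

lemma coordPoint_left (v : Fin (n + 1) → AlgebraicClosure k) (hv : v ≠ 0) :
    (coordPoint e v hv).left = projPoint v hv ≫ (trivIso e).inv ≫ pullback.fst _ _ := rfl

lemma exists_eq_coordPoint (x : GeometricPoint S) : ∃ v hv, x = coordPoint e v hv := by
  have hx : x.left ≫ S.hom = specAlgebraicClosure k := Over.w x
  obtain ⟨v, hv, h⟩ := exists_eq_projPoint
    (pullback.lift (f := S.hom) (g := specAlgebraicClosure k) x.left (𝟙 _)
      (by rw [hx]; exact (Category.id_comp _).symm) ≫ (trivIso e).hom) (by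
    rw [Category.assoc, trivIso_hom_projStructure, pullback.lift_snd])
  refine ⟨v, hv, ?_⟩
  ext1
  rw [coordPoint_left, ← h, Category.assoc, Iso.hom_inv_id_assoc, pullback.lift_fst]

lemma coordPoint_eq_iff {v w : Fin (n + 1) → AlgebraicClosure k} (hv : v ≠ 0) (hw : w ≠ 0) :
    coordPoint e v hv = coordPoint e w hw ↔ Proportional v w := by
  rw [← projPoint_eq_iff hv hw]
  constructor
  · intro h
    have h1 := congrArg (fun f => f.left) h
    simp only [coordPoint_left] at h1
    rw [← cancel_mono (trivIso e).inv]
    apply pullback.hom_ext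
    · simpa using h1
    · rw [Category.assoc, Category.assoc, trivIso_inv_snd, projPoint_projStructure,
        projPoint_projStructure]
  · intro h
    ext1
    rw [coordPoint_left, coordPoint_left, h]

lemma specMap_specAlgebraicClosure (τ : AlgebraicClosure k ≃ₐ[k] AlgebraicClosure k) :
    specMap (τ : AlgebraicClosure k ≃+* AlgebraicClosure k) ≫ specAlgebraicClosure k =
      specAlgebraicClosure k := by
  rw [specAlgebraicClosure, specMap, ← Spec.map_comp, ← CommRingCat.ofHom_comp]
  congr 2
  exact τ.toAlgHom.comp_algebraMap

/-- The semilinear endomorphism of `ℙⁿ` induced by an endomorphism of `S` and a Galois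
automorphism. -/
def inducedHom (τ : AlgebraicClosure k ≃ₐ[k] AlgebraicClosure k) (g : S ⟶ S) :
    Proj (grading n (AlgebraicClosure k)) ⟶ Proj (grading n (AlgebraicClosure k)) :=
  (trivIso e).inv ≫ pullback.map _ _ _ _ g.left
    (specMap (τ : AlgebraicClosure k ≃+* AlgebraicClosure k)) (𝟙 _)
    (by rw [Category.comp_id, Over.w g])
    (by rw [Category.comp_id, specMap_specAlgebraicClosure]) ≫ (trivIso e).hom

lemma inducedHom_projStructure (τ : AlgebraicClosure k ≃ₐ[k] AlgebraicClosure k) (g : S ⟶ S) :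
    inducedHom e τ g ≫ projStructure n (AlgebraicClosure k) =
      projStructure n (AlgebraicClosure k) ≫
        specMap (τ : AlgebraicClosure k ≃+* AlgebraicClosure k) := by
  rw [inducedHom, Category.assoc, Category.assoc, trivIso_hom_projStructure, pullback.lift_snd,
    ← Category.assoc, trivIso_inv_snd]

lemma inducedHom_fst (τ : AlgebraicClosure k ≃ₐ[k] AlgebraicClosure k) (g : S ⟶ S) :
    inducedHom e τ g ≫ (trivIso e).inv ≫ pullback.fst _ _ =
      ((trivIso e).inv ≫ pullback.fst _ _) ≫ g.left := by
  simp only [inducedHom, Category.assoc, Iso.hom_inv_id_assoc, pullback.lift_fst]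

/-- Through `e`, `ℙⁿ` is the fibre product of `S` and `Spec k̄`, so both projections determine a
morphism into it. -/
lemma proj_hom_ext {T : Scheme.{u}} {f g : T ⟶ Proj (grading n (AlgebraicClosure k))}
    (h : f ≫ (trivIso e).inv ≫ pullback.fst _ _ = g ≫ (trivIso e).inv ≫ pullback.fst _ _)
    (h' : f ≫ projStructure n _ = g ≫ projStructure n _) : f = g := by
  rw [← cancel_mono (trivIso e).inv]
  apply pullback.hom_ext
  · simpa using h
  · rw [Category.assoc, Category.assoc, trivIso_inv_snd, h']

/-- The semilinear automorphism of `ℙⁿ` induced by an automorphism of `S` and a Galois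
automorphism. -/
def inducedIso (τ : AlgebraicClosure k ≃ₐ[k] AlgebraicClosure k) (α : S ≅ S) :
    Proj (grading n (AlgebraicClosure k)) ≅ Proj (grading n (AlgebraicClosure k)) where
  hom := inducedHom e τ α.hom
  inv := inducedHom e τ.symm α.inv
  hom_inv_id := by
    apply proj_hom_ext e
    · have h : α.hom.left ≫ α.inv.left = 𝟙 _ := congrArg (fun f => f.left) α.hom_inv_id
      rw [Category.assoc, inducedHom_fst, ← Category.assoc, inducedHom_fst, Category.assoc,
        h, Category.comp_id, Category.id_comp]
    · rw [Category.assoc, inducedHom_projStructure, ← Category.assoc, inducedHom_projStructure,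
        Category.assoc, Category.id_comp]
      exact (congrArg (_ ≫ ·) (specMap_comp_symm _)).trans (Category.comp_id _)
  inv_hom_id := by
    apply proj_hom_ext e
    · have h : α.inv.left ≫ α.hom.left = 𝟙 _ := congrArg (fun f => f.left) α.inv_hom_id
      rw [Category.assoc, inducedHom_fst, ← Category.assoc, inducedHom_fst, Category.assoc,
        h, Category.comp_id, Category.id_comp]
    · rw [Category.assoc, inducedHom_projStructure, ← Category.assoc, inducedHom_projStructure,
        Category.assoc, Category.id_comp]
      exact (congrArg (_ ≫ ·) (specMap_symm_comp _)).trans (Category.comp_id _)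

/-- Automorphisms of `S` combined with Galois automorphisms act on homogeneous coordinates by
semilinear maps. -/
theorem exists_linearMap_coordPoint [NeZero n]
    (τ : AlgebraicClosure k ≃ₐ[k] AlgebraicClosure k) (α : S ≅ S) :
    ∃ A : (Fin (n + 1) → AlgebraicClosure k) →ₗ[AlgebraicClosure k]
        Fin (n + 1) → AlgebraicClosure k,
      ∀ v (hv : v ≠ 0), A v ≠ 0 ∧ ∀ u (hu : u ≠ 0), (∀ i, τ (u i) = A v i) →
        galoisAct τ.symm (coordPoint e v hv) ≫ α.hom = coordPoint e u hu := by
  obtain ⟨A, hA⟩ := exists_linearMap_of_iso (τ : AlgebraicClosure k ≃+* AlgebraicClosure k)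
    (inducedIso e τ α) (inducedHom_projStructure e τ α.hom)
  refine ⟨A, fun v hv => ⟨(hA v hv).1, fun u hu h => ?_⟩⟩
  have h1 := (hA v hv).2 u hu h
  ext1
  rw [coordPoint_left, ← h1]
  change (specMap _ ≫ projPoint v hv ≫ (trivIso e).inv ≫ pullback.fst _ _) ≫ α.hom.left =
    (specMap _ ≫ projPoint v hv ≫ inducedHom e τ α.hom) ≫ (trivIso e).inv ≫ pullback.fst _ _
  simp only [Category.assoc, inducedHom_fst]
  rfl

/-- An automorphism of `S` that fixes all geometric points is the identity. -/
theorem eq_one_of_fixes {n : ℕ}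
    (e : geometricBaseChange S ≅ projectiveSpace n (AlgebraicClosure k)) (α : Aut S)
    (h : ∀ x : GeometricPoint S, Fixes α x) : α = 1 := by
  have h1 : inducedHom e .refl α.hom = 𝟙 _ := by
    refine eq_id_of_projPoint_comp_eq _ ?_ fun v hv => ?_
    · rw [inducedHom_projStructure]
      exact (congrArg (_ ≫ ·) (Spec.map_id _)).trans (Category.comp_id _)
    · apply proj_hom_ext e
      · rw [Category.assoc, inducedHom_fst]
        have := congrArg (fun f => f.left) (h (coordPoint e v hv))
        simpa [coordPoint_left] using this
      · rw [Category.assoc, inducedHom_projStructure]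
        exact (congrArg (projPoint v hv ≫ projStructure n _ ≫ ·) (Spec.map_id _)).trans
          (by rw [Category.comp_id])
  -- Descent to `k`: the projection of the base change to `S` is flat and surjective, hence epi, and
  -- can be cancelled.
  have hflat : Flat (specAlgebraicClosure k) := by
    rw [specAlgebraicClosure, Flat.SpecMap_iff]
    exact RingHom.flat_algebraMap_iff.2 inferInstance
  have hsurj : Surjective (specAlgebraicClosure k) :=
    ⟨fun z => ⟨specPoint _, Subsingleton.elim _ _⟩⟩
  have : Epi (pullback.fst S.hom (specAlgebraicClosure k)) := Flat.epi_of_flat_of_surjective _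
  have h2 := inducedHom_fst e .refl α.hom
  rw [h1, Category.id_comp, Category.assoc, cancel_epi] at h2
  have h3 : α.hom.left = 𝟙 _ := by
    rw [← cancel_epi (pullback.fst S.hom (specAlgebraicClosure k)), ← h2, Category.comp_id]
  ext
  exact h3

end SeveriBrauer

end

/-! ### Fixed points as a single Galois orbit -/

noncomputable section

/-- `g` is invertible and every vector is an eigenvector of `g⁻¹ ∘ f`, which is therefore a
homothety. -/
lemma LinearMap.exists_eq_smul_of_proportional {σ K : Type*} [Finite σ] [Field K]
    {f g : (σ → K) →ₗ[K] σ → K} (hg : ∀ v, v ≠ 0 → g v ≠ 0)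
    (h : ∀ v, v ≠ 0 → Proportional (f v) (g v)) : ∃ c : K, ∀ v, f v = c • g v := by
  have hinj : Function.Injective g := by
    rw [← LinearMap.ker_eq_bot, LinearMap.ker_eq_bot']
    intro v hv
    by_contra h0
    exact hg v h0 hv
  let G := LinearEquiv.ofInjectiveEndo g hinj
  have hG : ∀ v, G v = g v := fun _ => rfl
  obtain ⟨c, hc⟩ := (G.symm.toLinearMap ∘ₗ f).exists_eq_smul_id_of_forall_notLinearIndependent
    fun v => by
      rw [LinearIndependent.pair_iff]
      push Not
      by_cases hv : v = 0
      · exact ⟨1, 0, by simp [hv]⟩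
      · obtain ⟨c, hc⟩ := (h v hv).symm.exists_smul (hg v hv)
        refine ⟨c, -1, ?_, by simp⟩
        rw [LinearMap.comp_apply, hc, map_smul]
        have : G.symm.toLinearMap (g v) = v := by rw [← hG]; exact G.symm_apply_apply v
        rw [this]
        simp
  refine ⟨c, fun v => ?_⟩
  have h1 : G (G.symm (f v)) = _ := congrArg G (LinearMap.congr_fun hc v)
  rw [G.apply_symm_apply] at h1
  simpa [hG] using h1

/-- The conjugate of a linear map by a field automorphism acting on coordinates. -/
def LinearMap.conjCoord {σ K : Type*} [Field K] (τ : K ≃+* K) (A : (σ → K) →ₗ[K] σ → K) :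
    (σ → K) →ₗ[K] σ → K where
  toFun v := τ.symm ∘ A (τ ∘ v)
  map_add' v w := by
    have : τ ∘ (v + w) = τ ∘ v + τ ∘ w := by ext; simp
    rw [this, map_add]
    ext; simp
  map_smul' c v := by
    have : τ ∘ (c • v) = τ c • (τ ∘ v) := by ext; simp
    rw [this, map_smul]
    ext; simp

namespace SeveriBrauer

variable {k : Type u} [Field k] {S : Over (Spec (.of k))}

lemma galoisAct_comp (τ : AlgebraicClosure k ≃ₐ[k] AlgebraicClosure k) (x : GeometricPoint S)
    (g : S ⟶ S) : galoisAct τ (x ≫ g) = galoisAct τ x ≫ g := by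
  ext1
  exact (Category.assoc _ _ _).symm

lemma galoisAct_refl (x : GeometricPoint S) : galoisAct .refl x = x := by
  ext1
  exact (congrArg (· ≫ x.left) (Spec.map_id _)).trans (Category.id_comp _)

lemma Fixes.galoisAct {α : Aut S} {x : GeometricPoint S} (h : Fixes α x)
    (τ : AlgebraicClosure k ≃ₐ[k] AlgebraicClosure k) : Fixes α (galoisAct τ x) := by
  rw [Fixes, ← galoisAct_comp, h]

lemma Fixes.components_subset {α : Aut S} {x : GeometricPoint S} (h : Fixes α x) :
    components x.support ⊆ {y | Fixes α y} := by
  intro y hy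
  obtain ⟨τ, rfl⟩ := exists_galoisAct_eq (x := x) (y := y) hy.symm
  exact h.galoisAct τ

/-- A Galois-invariant geometric point would give a `k`-point, so some conjugate of `x` differs from
`x`. -/
lemma one_lt_ncard_components [PerfectField k] (hS : ¬ IsTrivial S) {x : GeometricPoint S}
    (hfin : (components x.support).Finite) : 1 < (components x.support).ncard := by
  have h : ∃ τ, galoisAct τ x ≠ x := by
    by_contra! h
    exact hS (isTrivial_of_galoisAct_eq x h)
  obtain ⟨τ, hτ⟩ := h
  exact (Set.one_lt_ncard hfin).2 ⟨_, support_galoisAct τ x, x, rfl, hτ⟩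

section

variable {n : ℕ} [NeZero n] (e : geometricBaseChange S ≅ projectiveSpace n (AlgebraicClosure k))

lemma exists_linearMap_aut (α : Aut S) :
    ∃ A : (Fin (n + 1) → AlgebraicClosure k) →ₗ[AlgebraicClosure k]
        Fin (n + 1) → AlgebraicClosure k,
      ∀ v (hv : v ≠ 0), ∃ hA : A v ≠ 0, coordPoint e v hv ≫ α.hom = coordPoint e (A v) hA := by
  obtain ⟨A, hA⟩ := exists_linearMap_coordPoint e .refl α
  refine ⟨A, fun v hv => ⟨(hA v hv).1, ?_⟩⟩
  rw [← (hA v hv).2 (A v) (hA v hv).1 fun _ => rfl]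
  exact congrArg (· ≫ α.hom) (galoisAct_refl _).symm

/-- `B` accounts for the trivialization `e` not being Galois-equivariant: the action is `B` followed
by `τ` on coordinates. -/
lemma exists_linearMap_galoisAct (τ : AlgebraicClosure k ≃ₐ[k] AlgebraicClosure k) :
    ∃ B : (Fin (n + 1) → AlgebraicClosure k) →ₗ[AlgebraicClosure k]
        Fin (n + 1) → AlgebraicClosure k,
      ∀ v (hv : v ≠ 0), B v ≠ 0 ∧ ∀ hB : τ ∘ B v ≠ 0,
        galoisAct τ (coordPoint e v hv) = coordPoint e (τ ∘ B v) hB := by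
  obtain ⟨B, hB⟩ := exists_linearMap_coordPoint e τ.symm (Iso.refl S)
  refine ⟨B, fun v hv => ⟨(hB v hv).1, fun h => ?_⟩⟩
  rw [← (hB v hv).2 (τ ∘ B v) h fun _ => τ.symm_apply_apply _]
  exact (Category.comp_id _).symm

lemma comp_ne_zero {K σ : Type*} [Field K] (τ : K ≃+* K) {v : σ → K} (hv : v ≠ 0) :
    τ ∘ v ≠ 0 := fun h =>
  hv (funext fun i => τ.injective (by simpa using congrFun h i))

/-- A line that is canonical for the linear map of an automorphism is a Galois-invariant point. -/
lemma galoisAct_coordPoint_of_isCanonicalLine {α : Aut S}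
    {A : (Fin (n + 1) → AlgebraicClosure k) →ₗ[AlgebraicClosure k] Fin (n + 1) → AlgebraicClosure k}
    (hA : ∀ v (hv : v ≠ 0), ∃ hA : A v ≠ 0,
      coordPoint e v hv ≫ α.hom = coordPoint e (A v) hA)
    {v : Fin (n + 1) → AlgebraicClosure k} (hv : v ≠ 0) (hcan : IsCanonicalLine A v)
    (τ : AlgebraicClosure k ≃ₐ[k] AlgebraicClosure k) :
    galoisAct τ (coordPoint e v hv) = coordPoint e v hv := by
  obtain ⟨B, hB⟩ := exists_linearMap_galoisAct e τ
  let σ : AlgebraicClosure k ≃+* AlgebraicClosure k := τ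
  let T : (Fin (n + 1) → AlgebraicClosure k) →ₛₗ[(σ : AlgebraicClosure k →+* AlgebraicClosure k)]
      Fin (n + 1) → AlgebraicClosure k :=
    { toFun := fun v => τ ∘ B v
      map_add' := fun v w => by ext; simp
      map_smul' := fun c v => by ext; simp [σ] }
  have hTdef : ∀ v, T v = τ ∘ B v := fun _ => rfl
  have hT0 : ∀ v, v ≠ 0 → T v ≠ 0 := fun v hv => comp_ne_zero σ (hB v hv).1
  have hT : Function.Injective T := by
    rw [injective_iff_map_eq_zero]
    intro v hv
    by_contra h
    exact hT0 v h hv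
  have hTact : ∀ v (hv : v ≠ 0), galoisAct τ (coordPoint e v hv) =
      coordPoint e (T v) (hT0 v hv) := fun v hv => (hB v hv).2 _
  -- `A ∘ T` and `T ∘ A` agree on points because `α` commutes with the Galois action. Both are
  -- semilinear, so `τ` is stripped off to compare linear maps; reapplying it turns the scalar `c`
  -- into `σ c`.
  obtain ⟨c, hc⟩ := LinearMap.exists_eq_smul_of_proportional (f := A.conjCoord σ ∘ₗ B)
    (g := B ∘ₗ A) (fun v hv => (hB _ (hA v hv).1).1) (by
      intro v hv
      obtain ⟨h1, h2⟩ := hA v hv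
      obtain ⟨h3, h4⟩ := hA _ (hT0 v hv)
      have h5 : Proportional (A (T v)) (T (A v)) := by
        rw [← coordPoint_eq_iff e h3 (hT0 _ h1), ← h4, ← hTact v hv, ← hTact _ h1,
          ← galoisAct_comp, h2]
      rw [hTdef, hTdef] at h5
      have h6 := h5.map (σ.symm : AlgebraicClosure k →+* AlgebraicClosure k)
      intro i j
      simpa [LinearMap.conjCoord, σ] using h6 i j)
  have hcomm : ∀ v, A (T v) = σ c • T (A v) := by
    intro v
    rw [hTdef, hTdef]
    ext i
    have := congrArg σ (congrFun (hc v) i)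
    simpa [LinearMap.conjCoord, σ] using this
  have hc0 : σ c ≠ 0 := by
    intro h
    have := hcomm v
    rw [h, zero_smul] at this
    exact (hA _ (hT0 v hv)).1 this
  obtain ⟨t, ht⟩ := hcan σ T (σ c) hT hc0 hcomm
  rw [hTact, coordPoint_eq_iff, ht]
  exact (Proportional.smul_right v t).symm

end

/-- The fixed points of a nontrivial automorphism are the components of a single point. -/
theorem exists_fixedPoints_eq_components [PerfectField k]
    (e : geometricBaseChange S ≅ projectiveSpace 2 (AlgebraicClosure k))
    (hS : ¬ IsTrivial S) (α : Aut S) (hα : α ≠ 1) :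
    ∃ x : GeometricPoint S, {y | Fixes α y} = components x.support ∧
      (components x.support).ncard = 3 := by
  obtain ⟨A, hA⟩ := exists_linearMap_aut e α
  have hfix : ∀ v (hv : v ≠ 0), Fixes α (coordPoint e v hv) ↔ Proportional (A v) v := by
    intro v hv
    obtain ⟨h1, h2⟩ := hA v hv
    rw [Fixes, h2, coordPoint_eq_iff]
  have hscalar : ∀ a, A ≠ algebraMap (AlgebraicClosure k) (Module.End _ _) a := by
    rintro a rfl
    refine hα (eq_one_of_fixes e α fun x => ?_)
    obtain ⟨v, hv, rfl⟩ := exists_eq_coordPoint e x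
    rw [hfix]
    exact (Proportional.smul_right v a).symm
  rcases exists_isCanonicalLine_or (by simp) hscalar with ⟨v, hv, hcan⟩ | ⟨μ, b, hμ, hb⟩
  · exact absurd (isTrivial_of_galoisAct_eq _
      (galoisAct_coordPoint_of_isCanonicalLine e hA hv hcan)) hS
  let x : Fin 3 → GeometricPoint S := fun i => coordPoint e (b i) (hb i).2
  have hAb : ∀ i, A (b i) = μ i • b i := fun i => (hb i).apply_eq_smul
  have hx : Function.Injective x := by
    intro i j hij
    obtain ⟨c, hc⟩ := ((coordPoint_eq_iff e _ _).1 hij).exists_smul (hb i).2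
    have h1 := hAb j
    rw [hc, map_smul, hAb, smul_comm, ← hc] at h1
    exact hμ (smul_left_injective _ (hb j).2 h1)
  have hF : {y | Fixes α y} = Set.range x := by
    ext y
    constructor
    · intro hy
      obtain ⟨v, hv, rfl⟩ := exists_eq_coordPoint e y
      obtain ⟨c, hc⟩ := ((hfix v hv).1 hy).symm.exists_smul hv
      have hli := Module.End.eigenvectors_linearIndependent' A μ hμ b hb
      let B := basisOfLinearIndependentOfCardEqFinrank hli (by simp)
      have hB : ∀ i, B i = b i := fun i => by simp [B]
      -- In the eigenbasis, `A v = c • v` reads coordinatewise. As the `μ i` are distinct, only one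
      -- coordinate of `v` can be nonzero.
      have hrepr : ∀ i, c * B.repr v i = μ i * B.repr v i := by
        have h1 : A v = ∑ i, (B.repr v i * μ i) • B i := by
          conv_lhs => rw [← B.sum_repr v]
          simp only [map_sum, map_smul, hB, hAb, smul_smul]
        intro i
        have h2 := congrArg (fun w => B.repr w i) (hc.symm.trans h1)
        simp only [map_smul, Finsupp.smul_apply, smul_eq_mul, B.repr_sum_self] at h2
        rw [h2, mul_comm]
      obtain ⟨i, hi⟩ : ∃ i, B.repr v i ≠ 0 := by
        by_contra! h
        exact hv (B.repr.map_eq_zero_iff.1 (Finsupp.ext h))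
      have hci := mul_right_cancel₀ hi (hrepr i)
      refine ⟨i, (coordPoint_eq_iff e _ _).2 ?_⟩
      have hvi : v = B.repr v i • b i := by
        conv_lhs => rw [← B.sum_repr v]
        rw [Finset.sum_eq_single i, hB]
        · intro j _ hj
          have hj0 : B.repr v j = 0 := by
            by_contra h
            exact hj (hμ ((mul_right_cancel₀ h (hrepr j)).symm.trans hci))
          rw [hj0, zero_smul]
        · simp
      rw [hvi]
      exact Proportional.smul_right _ _
    · rintro ⟨i, rfl⟩
      change Fixes α _
      rw [hfix, hAb]
      exact (Proportional.smul_right _ _).symm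
  have hcard : {y | Fixes α y}.ncard = 3 := by
    rw [hF, Set.ncard_range_of_injective hx, Nat.card_fin]
  have hfin : {y : GeometricPoint S | Fixes α y}.Finite := Set.finite_of_ncard_pos (by omega)
  have h0 : Fixes α (x 0) := hF.ge ⟨0, rfl⟩
  have heq : {y | Fixes α y} = components (x 0).support := by
    refine Set.Subset.antisymm (fun y hy => ?_) h0.components_subset
    -- A second orbit would be disjoint from the first; with at least two points in each, there
    -- would be four fixed points.
    by_contra hne
    have hdisj : Disjoint (components (x 0).support) (components y.support) := by
      rw [Set.disjoint_left]
      intro z hz hz'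
      exact hne (hz'.symm.trans hz)
    have f1 := hfin.subset h0.components_subset
    have f2 := hfin.subset (Fixes.components_subset hy)
    have l1 := one_lt_ncard_components hS f1
    have l2 := one_lt_ncard_components hS f2
    have l3 := Set.ncard_union_eq hdisj f1 f2
    have l4 := Set.ncard_le_ncard
      (Set.union_subset h0.components_subset (Fixes.components_subset hy)) hfin
    omega
  exact ⟨x 0, heq, heq ▸ hcard⟩

lemma IsProjective.isSeparated (hS : IsProjective S) : IsSeparated S.hom := by
  obtain ⟨n, i, hi⟩ := hS
  have : IsSeparated (projectiveSpace n k).hom := inferInstanceAs (IsSeparated (projStructure n k))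
  rw [← Over.w i]
  infer_instance

end SeveriBrauer

end

/-! ### The main theorem -/

theorem mainTheorem8 {k : Type u} [Field k] [PerfectField k]
    (S : Over (Spec (.of k)))
    (hS : SeveriBrauer.IsSeveriBrauerSurface S)
    (hS_nontrivial : ¬ SeveriBrauer.IsTrivial S)
    (α : Aut S) (hα : α ≠ 1) :
    (∃! p : S.left, SeveriBrauer.IsDPoint 3 p ∧ SeveriBrauer.FixesComponentwise α p) ∧
      ∀ p : S.left, SeveriBrauer.IsDPoint 3 p → SeveriBrauer.FixesComponentwise α p →
        (SeveriBrauer.components p).ncard = 3 ∧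
          {x : SeveriBrauer.GeometricPoint S | SeveriBrauer.Fixes α x} =
            SeveriBrauer.components p := by
  obtain ⟨e⟩ := hS.geometric
  have := hS.projective.isSeparated
  obtain ⟨x, hx, hcard⟩ := SeveriBrauer.exists_fixedPoints_eq_components e hS_nontrivial α hα
  have huniq : ∀ p : S.left, SeveriBrauer.IsDPoint 3 p → SeveriBrauer.FixesComponentwise α p →
      p = x.support := by
    intro p hp hfix
    -- Componentwise fixing is not vacuous: a 3-point has three components. One of them already
    -- locates `p`.
    obtain ⟨y, hy⟩ : (SeveriBrauer.components p).Nonempty :=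
      Set.nonempty_of_ncard_ne_zero (by rw [hp.ncard_components]; norm_num)
    have h1 : y ∈ SeveriBrauer.components x.support := hx ▸ hfix y hy
    exact hy.symm.trans h1
  have := SeveriBrauer.isAlgebraic_residueField_support x
  refine ⟨⟨x.support, ⟨⟨SeveriBrauer.isClosed_singleton_support x, ?_⟩, ?_⟩, ?_⟩, ?_⟩
  · rw [← SeveriBrauer.ncard_components, hcard]
  · intro y hy
    exact hx.ge hy
  · rintro p ⟨hp, hfix⟩
    exact huniq p hp hfix
  · intro p hp hfix
    rw [huniq p hp hfix]
    exact ⟨hcard, hx⟩
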